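/- **Setting.** Let $a:[0,\infty)\to[0,\infty)$ be strongly regular: $a(0)=0$; $a$ is strictly increasing and continuous on $[0,\infty)$ with an inverse function on $[0,\infty)$; $a$ is $C^2$ on $(0,\infty)$ with $\dot a>0$ there; and for some constant $K\ge 1$, $-K\le a(t)\ddot a(t)/\dot a(t)^2\le 1$ for all $t>0$. Extend $a$ evenly by $a(-t)=a(t)$. For $\tau>0$ put $$\rho_{M_\tau}=\int_0^\tau\frac{a(t)\,dt}{\sqrt{a^2(\tau)-a^2(t)}},\qquad D=\{(\tau,\rho):\tau>0,\ 0<\rho<2\rho_{M_\tau}\}.$$ For $(\tau,\rho)\in D$ let $t_0=t_0(\tau,\rho)\in(-\tau,\tau)$ be defined implicitly by $\rho=\int_{t_0}^{\tau}\frac{a(t)\,dt}{\sqrt{a^2(\tau)-a^2(t)}}$. Let $$f(\tau,t_0)=\int_{t_0}^{\tau}\frac{\ddot a(t)}{\dot a(t)^2}\left(\frac{\sqrt{a^2(\tau)-a^2(t_0)}}{\sqrt{a^2(\tau)-a^2(t)}}-1\right)dt\quad(0\le t_0<\tau),\qquad f(\tau,t_0)=2f(\tau,0)-f(\tau,-t_0)\quad(-\tau<t_0<0),$$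 $$\mathbf f(\tau,\rho)=f(\tau,t_0(\tau,\rho)),\qquad g_{\tau\tau}(\tau,\rho)=-[1-\dot a(\tau)\mathbf f(\tau,\rho)]^2 .$$ **Theorem.** Assume in addition that $\dddot a$ exists on $(0,\infty)$, that there is a constant $C$ with $|\dddot a(t)a^2(t)/\dot a^3(t)|\le C$ for all $t>0$, that the limit $\dot a(0^+)=\lim_{t\to0^+}\dot a(t)$ exists, and that either (a) $\dot a(0^+)=0$ and $\ddot a\ge0$ on $(0,\epsilon)$ for some $\epsilon>0$, or (b) $0<\dot a(0^+)<\infty$. Then $D$ is open, $t_0$ is well defined (exists and is unique) on $D$, the big-bang locus $\rho=\rho_{M_\tau}$ lies in $D$ and is exactly the set where $t_0=0$, and $g_{\tau\tau}$ is continuously differentiable on $D$. Moreover, on all of $D$, $$\partial_\rho g_{\tau\tau}=2(1-\dot a(\tau)\mathbf f)\,\dot a(\tau)\,\partial_\rho\mathbf f,\qquad \partial_\tau g_{\tau\tau}=2(1-\dot a(\tau)\mathbf f)\,[\ddot a(\tau)\mathbf f+\dot a(\tau)\partial_\tau\mathbf f],$$ where $1-\dot a(\tau)\mathbf f=\sqrt{-g_{\tau\tau}}$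 whenever $\rho\le\rho_{M_\tau}$, and the partial derivatives of $\mathbf f$ exist and are given as follows. Write $$J(\tau,x)=\int_x^\tau\frac{\ddot a(t)}{\dot a(t)^2}\frac{dt}{\sqrt{a^2(\tau)-a^2(t)}}\ (0<x<\tau),\qquad R(\tau)=\frac{\dot a(\tau)}{a(\tau)}\int_0^\tau\left(1-\frac{a(t)\ddot a(t)}{\dot a^2(t)}\right)\frac{a(t)\,dt}{\sqrt{a^2(\tau)-a^2(t)}},$$ $$I_1(\tau,x)=-\frac{\dot a(\tau)}{a(\tau)}\int_x^\tau\left[3\frac{\ddot a^2(t)a(t)}{\dot a^4(t)}-\frac{\dddot a(t)a(t)}{\dot a^3(t)}\right]\left[\frac{\sqrt{a^2(\tau)-a^2(x)}}{\sqrt{a^2(\tau)-a^2(t)}}-1\right]dt,$$ $$I_2(\tau,x)=\frac{\dot a(\tau)}{a(\tau)}\int_x^\tau\frac{\ddot a(t)}{\dot a^2(t)}\left[\frac{a^2(\tau)}{\sqrt{a^2(\tau)-a^2(t)}\sqrt{a^2(\tau)-a^2(x)}}-1\right]dt,$$ $$E(\tau)=\frac{\dot a(\tau)}{a(\tau)}\int_0^\tau\left[\frac{\ddot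 a(t)}{\dot a^2(t)}+\frac{\dddot a(t)a(t)}{\dot a^3(t)}-3\frac{\ddot a^2(t)a(t)}{\dot a^4(t)}\right]\left[\frac{a(\tau)}{\sqrt{a^2(\tau)-a^2(t)}}-1\right]dt .$$ * At points with $\rho\ne\rho_{M_\tau}$, with $t_0=t_0(\tau,\rho)$: $$\partial_\rho\mathbf f=\dot a(|t_0|)\,J(\tau,|t_0|),\qquad \partial_\tau\mathbf f=F(\tau,t_0)-\frac{a(t_0)\dot a(|t_0|)}{\sqrt{a^2(\tau)-a^2(t_0)}}\,J(\tau,|t_0|)\cdot T(\tau,t_0),$$ where $F(\tau,t_0)=I_1(\tau,t_0)+I_2(\tau,t_0)$ if $t_0>0$, $F(\tau,t_0)=2E(\tau)-I_1(\tau,-t_0)-I_2(\tau,-t_0)$ if $t_0<0$, and $$T(\tau,t_0)=\frac{\sqrt{a^2(\tau)-a^2(t_0)}}{a(t_0)}\left[R(\tau)+a(\tau)\dot a(\tau)\int_0^{t_0}\frac{a(t)\,dt}{(a^2(\tau)-a^2(t))^{3/2}}\right].$$ * At the big-bang locus, $$\partial_\rho\mathbf f(\tau,\rho_{M_\tau})=q(\tau),\qquad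 \partial_\tau\mathbf f(\tau,\rho_{M_\tau})=E(\tau)-q(\tau)R(\tau),$$ where $q(\tau)=1/a(\tau)$ in case (a), and $q(\tau)=\dot a(0^+)\lim_{x\to0^+}J(\tau,x)$ in case (b), the limit existing and being finite for every $\tau>0$. -/

import Mathlib

open Set Filter Topology

/-- A regular scale factor. Only the values `a t` with `0 ≤ t` matter; the even extension to
negative cosmological times is written `a |t|` below. Surjectivity onto `[0, ∞)` together with
strict monotonicity is the existence of the inverse function on `[0, ∞)`, and positivity of the
derivative is what makes the quotient `a a'' / a' ^ 2` meaningful for every `t > 0`. -/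
structure RegularScaleFactor (a : ℝ → ℝ) : Prop where
  map_zero : a 0 = 0
  strictMonoOn : StrictMonoOn a (Ici 0)
  continuousOn : ContinuousOn a (Ici 0)
  surjOn : SurjOn a (Ici 0) (Ici 0)
  contDiffOn : ContDiffOn ℝ 2 a (Ioi 0)
  deriv_pos : ∀ t, 0 < t → 0 < deriv a t
  ratio_le_one : ∀ t, 0 < t → a t * deriv (deriv a) t / deriv a t ^ 2 ≤ 1

/-- A strongly regular scale factor: the quotient `a a'' / a' ^ 2` is also bounded below by a
constant `-K ≤ -1`. -/
structure StronglyRegularScaleFactor (a : ℝ → ℝ) : Prop extends RegularScaleFactor a where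
  ratio_ge : ∃ K : ℝ, 1 ≤ K ∧ ∀ t, 0 < t → -K ≤ a t * deriv (deriv a) t / deriv a t ^ 2

namespace FermiChart

/-- Proper distance `ρ` along the geodesic orthogonal to the central observer at proper time `τ`,
up to the event of cosmological time `t₀ ∈ (-τ, τ)`. -/
noncomputable def properDist (a : ℝ → ℝ) (τ t₀ : ℝ) : ℝ :=
  ∫ t in t₀..τ, a |t| / √(a τ ^ 2 - a |t| ^ 2)

/-- The Fermi radius `ρ_{M_τ}`: the proper distance to the big bang. -/
noncomputable def radius (a : ℝ → ℝ) (τ : ℝ) : ℝ :=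
  ∫ t in (0 : ℝ)..τ, a t / √(a τ ^ 2 - a t ^ 2)

/-- The domain `D = {(τ, ρ) : τ > 0, 0 < ρ < 2 ρ_{M_τ}}`. -/
def domain (a : ℝ → ℝ) : Set (ℝ × ℝ) :=
  {p | 0 < p.1 ∧ 0 < p.2 ∧ p.2 < 2 * radius a p.1}

/-- The cosmological time `t₀(τ, ρ)`, defined implicitly by `-τ < t₀ < τ` and
`properDist a τ t₀ = ρ`. -/
noncomputable def cosmicTime (a : ℝ → ℝ) (τ ρ : ℝ) : ℝ :=
  Classical.epsilon fun t₀ : ℝ => t₀ ∈ Ioo (-τ) τ ∧ properDist a τ t₀ = ρ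

/-- `f(τ, t₀)` for `0 ≤ t₀ < τ`. -/
noncomputable def fNonneg (a : ℝ → ℝ) (τ t₀ : ℝ) : ℝ :=
  ∫ t in t₀..τ, deriv (deriv a) t / deriv a t ^ 2 *
    (√(a τ ^ 2 - a t₀ ^ 2) / √(a τ ^ 2 - a t ^ 2) - 1)

/-- `f(τ, t₀)` for `-τ < t₀ < τ`, reflected to negative `t₀`. -/
noncomputable def f (a : ℝ → ℝ) (τ t₀ : ℝ) : ℝ :=
  if 0 ≤ t₀ then fNonneg a τ t₀ else 2 * fNonneg a τ 0 - fNonneg a τ (-t₀)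

/-- The function `𝐟(τ, ρ) = f(τ, t₀(τ, ρ))`. -/
noncomputable def fF (a : ℝ → ℝ) (τ ρ : ℝ) : ℝ := f a τ (cosmicTime a τ ρ)

/-- The extended Fermi metric coefficient `g_ττ(τ, ρ)`. -/
noncomputable def gττ (a : ℝ → ℝ) (τ ρ : ℝ) : ℝ := -(1 - deriv a τ * fF a τ ρ) ^ 2

/-- `∫ t in x..τ, a'' / a' ^ 2 / √(a(τ)² - a(t)²)`, used for `0 < x < τ`. -/
noncomputable def J (a : ℝ → ℝ) (τ x : ℝ) : ℝ :=
  ∫ t in x..τ, deriv (deriv a) t / deriv a t ^ 2 * (1 / √(a τ ^ 2 - a t ^ 2))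

/-- The improper integral `∫_{0⁺}^τ`, i.e. the limit of `J a τ x` as `x → 0⁺`
(the integrand need not be absolutely integrable near `0`). -/
noncomputable def Jzero (a : ℝ → ℝ) (τ : ℝ) : ℝ := limUnder (𝓝[>] (0 : ℝ)) (J a τ)

/-- The integral formula for `dρ_{M_τ} / dτ`. -/
noncomputable def radiusDeriv (a : ℝ → ℝ) (τ : ℝ) : ℝ :=
  deriv a τ / a τ *
    ∫ t in (0 : ℝ)..τ, (1 - a t * deriv (deriv a) t / deriv a t ^ 2) *
      (a t / √(a τ ^ 2 - a t ^ 2))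

/-- The integral formula for the `τ`-derivative of `G(τ, t₀) = ∫_0^{t₀} a / √(a(τ)² - a²)`. -/
noncomputable def dτG (a : ℝ → ℝ) (τ t₀ : ℝ) : ℝ :=
  -(a τ * deriv a τ) * ∫ t in (0 : ℝ)..t₀, a |t| / (a τ ^ 2 - a |t| ^ 2) ^ (3 / 2 : ℝ)

/-- The formula for `∂t₀/∂τ` where `t₀ ≠ 0`. -/
noncomputable def dτt₀ (a : ℝ → ℝ) (τ t₀ : ℝ) : ℝ :=
  √(a τ ^ 2 - a |t₀| ^ 2) / a |t₀| * (radiusDeriv a τ - dτG a τ t₀)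

/-- The formula for `∂f/∂t₀` where `t₀ ≠ 0`. -/
noncomputable def dt₀f (a : ℝ → ℝ) (τ t₀ : ℝ) : ℝ :=
  -(a |t₀| * deriv a |t₀| / √(a τ ^ 2 - a |t₀| ^ 2)) * J a τ |t₀|

noncomputable def I₁ (a : ℝ → ℝ) (τ t₀ : ℝ) : ℝ :=
  -(deriv a τ / a τ) *
    ∫ t in t₀..τ, (3 * (deriv (deriv a) t ^ 2 * a t / deriv a t ^ 4)
        - deriv (deriv (deriv a)) t * a t / deriv a t ^ 3) *
      (√(a τ ^ 2 - a t₀ ^ 2) / √(a τ ^ 2 - a t ^ 2) - 1)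

noncomputable def I₂ (a : ℝ → ℝ) (τ t₀ : ℝ) : ℝ :=
  deriv a τ / a τ *
    ∫ t in t₀..τ, deriv (deriv a) t / deriv a t ^ 2 *
      (a τ ^ 2 / (√(a τ ^ 2 - a t ^ 2) * √(a τ ^ 2 - a t₀ ^ 2)) - 1)

/-- The formula for `∂f/∂τ (τ, 0)`. -/
noncomputable def dτfzero (a : ℝ → ℝ) (τ : ℝ) : ℝ :=
  deriv a τ / a τ *
    ∫ t in (0 : ℝ)..τ, (deriv (deriv a) t / deriv a t ^ 2
        + deriv (deriv (deriv a)) t * a t / deriv a t ^ 3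
        - 3 * (deriv (deriv a) t ^ 2 * a t / deriv a t ^ 4)) *
      (a τ / √(a τ ^ 2 - a t ^ 2) - 1)

/-- The formula for `∂f/∂τ (τ, t₀)` where `t₀ ≠ 0`. -/
noncomputable def dτf (a : ℝ → ℝ) (τ t₀ : ℝ) : ℝ :=
  if 0 < t₀ then I₁ a τ t₀ + I₂ a τ t₀
  else 2 * dτfzero a τ - I₁ a τ (-t₀) - I₂ a τ (-t₀)

/-- The value of `∂𝐟/∂ρ` at the big bang `ρ = ρ_{M_τ}`, where `v = a'(0⁺)`. -/
noncomputable def dρfBang (a : ℝ → ℝ) (v τ : ℝ) : ℝ :=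
  if v = 0 then 1 / a τ else v * Jzero a τ

open Classical in
/-- The formula for `∂𝐟/∂ρ (τ, ρ)`, where `v = a'(0⁺)`. -/
noncomputable def dρfF (a : ℝ → ℝ) (v τ ρ : ℝ) : ℝ :=
  if ρ = radius a τ then dρfBang a v τ
  else deriv a |cosmicTime a τ ρ| * J a τ |cosmicTime a τ ρ|

open Classical in
/-- The formula for `∂𝐟/∂τ (τ, ρ)`, where `v = a'(0⁺)`. -/
noncomputable def dτfF (a : ℝ → ℝ) (v τ ρ : ℝ) : ℝ :=
  if ρ = radius a τ then dτfzero a τ - dρfBang a v τ * radiusDeriv a τ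
  else dτf a τ (cosmicTime a τ ρ) + dt₀f a τ (cosmicTime a τ ρ) * dτt₀ a τ (cosmicTime a τ ρ)

end FermiChart

open MeasureTheory

/-! Put A = a(τ) and substitute a(t) = A sin s, a(t₀) = A sin θ, with negative angles for negative
times. Let b be the inverse of a and u = A sin s. For θ ≥ 0 the proper distance becomes P(A, θ) =
∫_θ^{π/2} u b'(u) ds, and f becomes F(A, θ) = -∫_θ^{π/2} A b''(u) (cos θ - cos s) ds; the
singularity at t = τ is gone. The hypotheses on a turn into bounds for b', b'', b'''
(`inverseProfile`). Since |u b''| and |u² b'''| are at most K b' and (cos θ - cos s) / sin² s ≤ 1 /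
(1 + cos s), both integrals can be differentiated in A under the integral sign, down to θ = 0. For θ
< 0, P is continued by evenness of its integrand and F by reflection.

The difficulty is the big bang θ = 0: there ∂P/∂θ = -A sin θ b'(A sin θ) vanishes, so the implicit
function theorem does not apply. However, ∂F/∂θ = Q ∂P/∂θ for θ ≠ 0, where for θ > 0 one has Q = -(1
/ b'(A sin θ)) ∫_θ^{π/2} b''(A sin s) ds. Splitting 1 = cos s + (1 - cos s) in this integral shows
that Q extends continuously across θ = 0 (`slope_eq`, `continuousOn_slope`). Integrating in θ gives
ΔF = Q ΔP up to ε |ΔP|, locally uniformly in A (`eventually_abs_reflect_lapse_sub_le`). Hence F, as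
a function of (A, ρ), is differentiable with ∂_ρ = Q and ∂_A = F_A - Q P_A, without division by
∂P/∂θ (`hasFDerivAt_potential`).

For a C¹ function F_A must be jointly continuous, although its integrand contains b''', which need
not be continuous. An integration by parts removes b''' (`lapseDeriv_eq_of_pos`). Translating back,
the terms in tan θ that arise from fixing t₀ instead of θ cancel (`dτfF_eq`). The identification
with the square root rests on f ≤ b'(A) = 1 / a'(τ) for nonnegative angles (`lapse_le`). -/

/-- Bounds satisfied by the first three derivatives `b₁`, `b₂`, `b₃` on `(0, ∞)` of the inverse of a
strongly regular scale factor; `v` is the limit of `1 / b₁` at `0⁺`. -/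
structure InverseProfile (b₁ b₂ b₃ : ℝ → ℝ) (v K : ℝ) : Prop where
  pos : ∀ u, 0 < u → 0 < b₁ u
  hasDerivAt_one : ∀ u, 0 < u → HasDerivAt b₁ (b₂ u) u
  hasDerivAt_two : ∀ u, 0 < u → HasDerivAt b₂ (b₃ u) u
  lower : ∀ u, 0 < u → 0 ≤ b₁ u + u * b₂ u
  second : ∀ u, 0 < u → |u * b₂ u| ≤ K * b₁ u
  third : ∀ u, 0 < u → |u ^ 2 * b₃ u| ≤ K * b₁ u
  small : Tendsto (fun u => u * b₁ u) (𝓝[>] 0) (𝓝 0)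
  speed : Tendsto (fun u => 1 / b₁ u) (𝓝[>] 0) (𝓝 v)

/-! ### Even extensions of the profile functions: continuity, bounds, monotonicity. -/

namespace InverseProfile

/-- The even extension of `u * b₁ u`. -/
noncomputable def flux (b₁ : ℝ → ℝ) (u : ℝ) : ℝ := |u| * b₁ |u|

/-- The even extension of `u ^ 2 * b₂ u`. -/
noncomputable def bend (b₂ : ℝ → ℝ) (u : ℝ) : ℝ := u ^ 2 * b₂ |u|

/-- The even extension of `u ^ 2 * (u * b₂ u)'`. -/
noncomputable def bendDeriv (b₂ b₃ : ℝ → ℝ) (u : ℝ) : ℝ := u ^ 2 * b₂ |u| + |u| ^ 3 * b₃ |u|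

/-- The even extension of `1 / b₁ u`, with value `v` at `0`. -/
noncomputable def rate (b₁ : ℝ → ℝ) (v u : ℝ) : ℝ := if u = 0 then v else 1 / b₁ |u|

variable {b₁ b₂ b₃ : ℝ → ℝ} {v K : ℝ}

theorem nonneg_bound (h : InverseProfile b₁ b₂ b₃ v K) : 0 ≤ K :=
  nonneg_of_mul_nonneg_left ((abs_nonneg _).trans (h.second 1 one_pos)) (h.pos 1 one_pos)

theorem flux_zero : flux b₁ 0 = 0 := by simp [flux]

theorem flux_neg (u : ℝ) : flux b₁ (-u) = flux b₁ u := by simp [flux]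

theorem bend_neg (u : ℝ) : bend b₂ (-u) = bend b₂ u := by simp [bend]

theorem rate_neg (u : ℝ) : rate b₁ v (-u) = rate b₁ v u := by simp [rate]

theorem flux_of_pos {u : ℝ} (hu : 0 < u) : flux b₁ u = u * b₁ u := by
  simp [flux, abs_of_pos hu]

theorem bend_of_pos {u : ℝ} (hu : 0 < u) : bend b₂ u = u ^ 2 * b₂ u := by
  simp [bend, abs_of_pos hu]

theorem rate_of_pos {u : ℝ} (hu : 0 < u) : rate b₁ v u = 1 / b₁ u := by
  simp [rate, abs_of_pos hu, hu.ne']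

theorem flux_pos (h : InverseProfile b₁ b₂ b₃ v K) {u : ℝ} (hu : u ≠ 0) : 0 < flux b₁ u :=
  mul_pos (abs_pos.2 hu) (h.pos _ (abs_pos.2 hu))

theorem flux_nonneg (h : InverseProfile b₁ b₂ b₃ v K) (u : ℝ) : 0 ≤ flux b₁ u := by
  rcases eq_or_ne u 0 with rfl | hu
  · simp [flux_zero]
  · exact (h.flux_pos hu).le

theorem tendsto_comp_abs {g : ℝ → ℝ} {c : ℝ} (hg : Tendsto g (𝓝[>] 0) (𝓝 c)) :
    Tendsto (fun u => g |u|) (𝓝[≠] 0) (𝓝 c) := by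
  refine hg.comp (tendsto_nhdsWithin_iff.2 ⟨?_, ?_⟩)
  · simpa using (continuous_abs.tendsto (0 : ℝ)).mono_left nhdsWithin_le_nhds
  · filter_upwards [self_mem_nhdsWithin] with u hu using abs_pos.2 hu

theorem continuous_flux (h : InverseProfile b₁ b₂ b₃ v K) : Continuous (flux b₁) := by
  refine continuous_iff_continuousAt.2 fun u => ?_
  rcases eq_or_ne u 0 with rfl | hu
  · rw [continuousAt_iff_punctured_nhds, flux_zero]
    exact tendsto_comp_abs h.small
  · exact continuous_abs.continuousAt.mul
      ((h.hasDerivAt_one _ (abs_pos.2 hu)).continuousAt.comp continuous_abs.continuousAt)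

theorem abs_bend_le (h : InverseProfile b₁ b₂ b₃ v K) (u : ℝ) : |bend b₂ u| ≤ K * flux b₁ u := by
  rcases eq_or_ne u 0 with rfl | hu
  · simp [bend, flux]
  · have := mul_le_mul_of_nonneg_left (h.second _ (abs_pos.2 hu)) (abs_nonneg u)
    rw [bend, flux, ← sq_abs]
    calc |(|u| ^ 2 * b₂ |u|)| = |u| * |(|u| * b₂ |u|)| := by
          rw [pow_two, mul_assoc, abs_mul, abs_abs]
      _ ≤ _ := this
      _ = _ := by ring

theorem abs_bendDeriv_le (h : InverseProfile b₁ b₂ b₃ v K) (u : ℝ) :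
    |bendDeriv b₂ b₃ u| ≤ 2 * K * flux b₁ u := by
  have h1 := h.abs_bend_le u
  have h2 : |(|u| ^ 3 * b₃ |u|)| ≤ K * flux b₁ u := by
    rcases eq_or_ne u 0 with rfl | hu
    · simp [flux]
    · have := mul_le_mul_of_nonneg_left (h.third _ (abs_pos.2 hu)) (abs_nonneg u)
      calc |(|u| ^ 3 * b₃ |u|)| = |u| * |(|u| ^ 2 * b₃ |u|)| := by
            rw [pow_succ', mul_assoc, abs_mul, abs_abs]
        _ ≤ _ := this
        _ = _ := by rw [flux]; ring
  calc _ ≤ |bend b₂ u| + |(|u| ^ 3 * b₃ |u|)| := abs_add_le _ _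
    _ ≤ _ := by linarith

theorem continuous_bend (h : InverseProfile b₁ b₂ b₃ v K) : Continuous (bend b₂) := by
  refine continuous_iff_continuousAt.2 fun u => ?_
  rcases eq_or_ne u 0 with rfl | hu
  · have hz : bend b₂ 0 = 0 := by simp [bend]
    rw [ContinuousAt, hz]
    refine squeeze_zero_norm h.abs_bend_le ?_
    have := (h.continuous_flux.const_mul K).tendsto 0
    simpa [flux_zero] using this
  · exact (continuous_id.pow 2).continuousAt.mul
      ((h.hasDerivAt_two _ (abs_pos.2 hu)).continuousAt.comp continuous_abs.continuousAt)

/-- Nothing is assumed about the regularity of b₃, but away from 0 it enters only as `deriv b₂`, and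
the derivative of any real function is measurable; the factor |u|³ hides the value at 0. -/
theorem measurable_bendDeriv (h : InverseProfile b₁ b₂ b₃ v K) :
    Measurable (bendDeriv b₂ b₃) := by
  have : bendDeriv b₂ b₃ = fun u => bend b₂ u + |u| ^ 3 * deriv b₂ |u| := by
    ext u
    rcases eq_or_ne u 0 with rfl | hu
    · simp [bend, bendDeriv]
    · rw [(h.hasDerivAt_two _ (abs_pos.2 hu)).deriv]; rfl
  rw [this]
  have h1 : Measurable fun u : ℝ => |u| := continuous_abs.measurable
  exact h.continuous_bend.measurable.add
    ((h1.pow_const 3).mul ((measurable_deriv b₂).comp h1))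

theorem continuous_rate (h : InverseProfile b₁ b₂ b₃ v K) : Continuous (rate b₁ v) := by
  refine continuous_iff_continuousAt.2 fun u => ?_
  rcases eq_or_ne u 0 with rfl | hu
  · rw [continuousAt_iff_punctured_nhds, rate, if_pos rfl]
    refine (tendsto_comp_abs h.speed).congr' ?_
    filter_upwards [self_mem_nhdsWithin] with u hu using (if_neg hu).symm
  · have : rate b₁ v =ᶠ[𝓝 u] fun u => 1 / b₁ |u| := by
      filter_upwards [isOpen_ne.mem_nhds hu] with u hu using by rw [rate, if_neg hu]
    refine ContinuousAt.congr ?_ this.symm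
    exact continuousAt_const.div ((h.hasDerivAt_one _ (abs_pos.2 hu)).continuousAt.comp
      continuous_abs.continuousAt) (h.pos _ (abs_pos.2 hu)).ne'

theorem hasDerivAt_flux (h : InverseProfile b₁ b₂ b₃ v K) {u : ℝ} (hu : 0 < u) :
    HasDerivAt (flux b₁) ((flux b₁ u + bend b₂ u) / u) u := by
  have := (hasDerivAt_id u).mul (h.hasDerivAt_one u hu)
  refine (this.congr_of_eventuallyEq ?_).congr_deriv ?_
  · filter_upwards [lt_mem_nhds hu] with w hw using flux_of_pos hw
  · rw [flux_of_pos hu, bend_of_pos hu]; simp; field_simp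

/-- The derivative of u b₁(u) is b₁ + u b₂, which `lower` makes nonnegative. This monotonicity
supplies all uniform bounds: `flux` at A sin s is dominated by `flux` at A. -/
theorem flux_monotoneOn (h : InverseProfile b₁ b₂ b₃ v K) : MonotoneOn (flux b₁) (Ici 0) := by
  refine monotoneOn_of_deriv_nonneg (convex_Ici 0) h.continuous_flux.continuousOn ?_ ?_
  · intro u hu
    rw [interior_Ici] at hu
    exact (h.hasDerivAt_flux hu).differentiableAt.differentiableWithinAt
  · intro u hu
    rw [interior_Ici] at hu
    have hu' : 0 < u := hu
    rw [(h.hasDerivAt_flux hu).deriv, flux_of_pos hu, bend_of_pos hu]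
    have := h.lower u hu
    exact div_nonneg (by nlinarith) hu'.le

theorem flux_le (h : InverseProfile b₁ b₂ b₃ v K) {u w : ℝ} (huw : |u| ≤ w) :
    flux b₁ u ≤ flux b₁ w := by
  have : flux b₁ u = flux b₁ |u| := by simp [flux]
  rw [this]
  exact h.flux_monotoneOn (abs_nonneg u) ((abs_nonneg u).trans huw) huw

theorem hasDerivAt_flux_mul (h : InverseProfile b₁ b₂ b₃ v K) {A : ℝ} (hA : 0 < A) (c : ℝ) :
    HasDerivAt (fun A => flux b₁ (A * c)) ((flux b₁ (A * c) + bend b₂ (A * c)) / A) A := by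
  wlog hc : 0 ≤ c generalizing c
  · have := this (-c) (by linarith)
    simpa only [mul_neg, flux_neg, bend_neg] using this
  rcases hc.eq_or_lt with rfl | hc
  · simpa [flux, bend] using hasDerivAt_const A (0 : ℝ)
  · refine ((h.hasDerivAt_flux (mul_pos hA hc)).comp A
      ((hasDerivAt_id A).mul_const c)).congr_deriv ?_
    field_simp

/-- With u = A c the function is c · u b₂(u). For c = 1 this is also the derivative of u b₂(u), the
form used in the integration by parts below. -/
theorem hasDerivAt_bend_mul (h : InverseProfile b₁ b₂ b₃ v K) {A : ℝ} (hA : 0 < A) (c : ℝ) :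
    HasDerivAt (fun A => bend b₂ (A * c) / A) (bendDeriv b₂ b₃ (A * c) / A ^ 2) A := by
  wlog hc : 0 ≤ c generalizing c
  · have := this (-c) (by linarith)
    simpa only [bend, bendDeriv, mul_neg, abs_neg, neg_sq] using this
  rcases hc.eq_or_lt with rfl | hc
  · simpa [bend, bendDeriv] using hasDerivAt_const A (0 : ℝ)
  · have hAc := mul_pos hA hc
    have h1 : HasDerivAt (fun A => b₂ (A * c)) (b₃ (A * c) * (1 * c)) A :=
      (h.hasDerivAt_two _ hAc).comp A ((hasDerivAt_id A).mul_const c)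
    have h2 := ((hasDerivAt_id A).mul_const (c ^ 2)).mul h1
    refine (h2.congr_of_eventuallyEq ?_).congr_deriv ?_
    · filter_upwards [lt_mem_nhds hA] with w hw
      rw [bend_of_pos (mul_pos hw hc)]
      simp only [id, Pi.mul_apply]
      field_simp
    · simp only [bendDeriv, abs_of_pos hAc, id]
      field_simp

end InverseProfile

/-! ### Parametric integrals with constant bounds. -/

open Real intervalIntegral in
/-- Differentiation under the integral sign with a constant bound. -/
theorem hasDerivAt_integral_of_bounded {g g' : ℝ → ℝ → ℝ} {a b x₀ B B' : ℝ} {s : Set ℝ}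
    (hs : s ∈ 𝓝 x₀) (hm : ∀ x, Measurable (g x)) (hm' : Measurable (g' x₀))
    (hB : ∀ t ∈ uIoc a b, |g x₀ t| ≤ B) (hB' : ∀ x ∈ s, ∀ t ∈ uIoc a b, |g' x t| ≤ B')
    (hd : ∀ t ∈ uIoc a b, ∀ x ∈ s, HasDerivAt (fun x => g x t) (g' x t) x) :
    HasDerivAt (fun x => ∫ t in a..b, g x t) (∫ t in a..b, g' x₀ t) x₀ := by
  refine (hasDerivAt_integral_of_dominated_loc_of_deriv_le (bound := fun _ => B') hs
    (.of_forall fun x => (hm x).aestronglyMeasurable) ?_ hm'.aestronglyMeasurable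
    (.of_forall fun t ht x hx => hB' x hx t ht) intervalIntegrable_const
    (.of_forall fun t ht x hx => hd t ht x hx)).2
  refine (intervalIntegrable_const (c := B)).mono_fun (hm x₀).aestronglyMeasurable ?_
  refine (ae_restrict_iff' measurableSet_uIoc).2 (.of_forall fun t ht => ?_)
  exact (hB t ht).trans (le_abs_self B)

theorem intervalIntegrable_of_bounded {g : ℝ → ℝ} {a b B : ℝ} (hm : Measurable g)
    (hB : ∀ t ∈ uIoc a b, |g t| ≤ B) : IntervalIntegrable g volume a b := by
  refine (intervalIntegrable_const (c := B)).mono_fun hm.aestronglyMeasurable ?_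
  refine (ae_restrict_iff' measurableSet_uIoc).2 (.of_forall fun t ht => ?_)
  exact (hB t ht).trans (le_abs_self B)

/-! ### Distance and f in the angular coordinates (A, θ), and their derivatives in A. -/

namespace InverseProfile

open Real

variable {b₁ b₂ b₃ : ℝ → ℝ} {v K : ℝ}

/-- The angular kernel `(cos θ - cos s)⁺ / sin² s`. -/
noncomputable def kernel (θ s : ℝ) : ℝ := max 0 (cos θ - cos s) / sin s ^ 2

theorem uIoc_zero_pi_div_two : uIoc 0 (π / 2) = Ioc 0 (π / 2) := uIoc_of_le (by positivity)

theorem sin_pos_of_mem {s : ℝ} (hs : s ∈ Ioc 0 (π / 2)) : 0 < sin s :=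
  sin_pos_of_pos_of_lt_pi hs.1 (by linarith [hs.2, pi_pos])

theorem cos_nonneg_of_mem {s : ℝ} (hs : s ∈ Ioc 0 (π / 2)) : 0 ≤ cos s :=
  cos_nonneg_of_neg_pi_div_two_le_of_le (by linarith [hs.1, pi_pos]) hs.2

theorem kernel_nonneg (θ s : ℝ) : 0 ≤ kernel θ s :=
  div_nonneg (le_max_left _ _) (sq_nonneg _)

/-- The numerator is at most 1 - cos s, and sin² s = (1 - cos s)(1 + cos s). The sharp bound, rather
than 1, is needed for the sign of 1 - a' f. -/
theorem kernel_le {θ s : ℝ} (hs : s ∈ Ioc 0 (π / 2)) : kernel θ s ≤ 1 / (1 + cos s) := by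
  have h1 := sin_pos_of_mem hs
  have h2 := cos_nonneg_of_mem hs
  rw [kernel, div_le_div_iff₀ (by positivity) (by positivity), one_mul, sin_sq]
  have h3 : max 0 (cos θ - cos s) ≤ 1 - cos s :=
    max_le (by linarith [cos_le_one s]) (by linarith [cos_le_one θ])
  nlinarith

theorem kernel_le_one {θ s : ℝ} (hs : s ∈ Ioc 0 (π / 2)) : kernel θ s ≤ 1 := by
  refine (kernel_le hs).trans ?_
  have h2 := cos_nonneg_of_mem hs
  rw [div_le_one (by positivity)]
  linarith

theorem measurable_kernel (θ : ℝ) : Measurable (kernel θ) := by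
  unfold kernel; fun_prop

theorem continuous_kernel (s : ℝ) : Continuous fun θ => kernel θ s := by
  unfold kernel; fun_prop

theorem kernel_eq_zero {θ s : ℝ} (hθ : θ ≤ π) (hs : 0 ≤ s) (hsθ : s ≤ θ) : kernel θ s = 0 := by
  rw [kernel, max_eq_left, zero_div]
  linarith [cos_le_cos_of_nonneg_of_le_pi hs hθ hsθ]

theorem kernel_eq {θ s : ℝ} (hθ : 0 ≤ θ) (hs : s ≤ π) (hsθ : θ ≤ s) :
    kernel θ s = (cos θ - cos s) / sin s ^ 2 := by
  rw [kernel, max_eq_right]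
  linarith [cos_le_cos_of_nonneg_of_le_pi hθ hs hsθ]

theorem abs_mul_kernel_le {m : ℝ → ℝ} {B : ℝ} {θ s : ℝ} (hB : |m s| ≤ B)
    (hs : s ∈ Ioc 0 (π / 2)) : |m s * kernel θ s| ≤ B := by
  rw [abs_mul, abs_of_nonneg (kernel_nonneg _ _)]
  nlinarith [kernel_le_one (θ := θ) hs, abs_nonneg (m s), kernel_nonneg θ s]

/-- Truncating the kernel at 0 moves the dependence on θ from the endpoint into the integrand, so
dominated convergence applies on a fixed interval. -/
theorem continuous_integral_kernel {m : ℝ → ℝ} {B : ℝ} (hm : Measurable m)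
    (hB : ∀ s ∈ Ioc 0 (π / 2), |m s| ≤ B) :
    Continuous fun θ => ∫ s in (0 : ℝ)..π / 2, m s * kernel θ s := by
  refine intervalIntegral.continuous_of_dominated_interval (bound := fun _ => B)
    (fun θ => (hm.mul (measurable_kernel θ)).aestronglyMeasurable)
    (fun θ => .of_forall fun s hs => ?_) intervalIntegrable_const
    (.of_forall fun s _ => continuous_const.mul (continuous_kernel s))
  rw [uIoc_zero_pi_div_two] at hs
  exact abs_mul_kernel_le (hB s hs) hs

theorem integral_kernel_eq {m : ℝ → ℝ} {B θ : ℝ} (hm : Measurable m)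
    (hB : ∀ s ∈ Ioc 0 (π / 2), |m s| ≤ B) (h0 : 0 ≤ θ) (h1 : θ ≤ π / 2) :
    ∫ s in (0 : ℝ)..π / 2, m s * kernel θ s =
      ∫ s in θ..π / 2, m s * ((cos θ - cos s) / sin s ^ 2) := by
  have hi : IntervalIntegrable (fun s => m s * kernel θ s) volume 0 (π / 2) := by
    refine intervalIntegrable_of_bounded (B := B) (hm.mul (measurable_kernel θ)) fun s hs => ?_
    rw [uIoc_zero_pi_div_two] at hs
    exact abs_mul_kernel_le (hB s hs) hs
  have hi1 := hi.mono_set (c := 0) (d := θ) (by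
    rw [uIcc_of_le h0, uIcc_of_le (by positivity)]; exact Icc_subset_Icc_right h1)
  have hi2 := hi.mono_set (c := θ) (d := π / 2) (by
    rw [uIcc_of_le h1, uIcc_of_le (by positivity)]; exact Icc_subset_Icc_left h0)
  rw [← intervalIntegral.integral_add_adjacent_intervals hi1 hi2]
  have hz : ∫ s in (0 : ℝ)..θ, m s * kernel θ s = ∫ s in (0 : ℝ)..θ, (0 : ℝ) := by
    refine intervalIntegral.integral_congr fun s hs => ?_
    rw [uIcc_of_le h0] at hs
    rw [kernel_eq_zero (by linarith [pi_pos]) hs.1 hs.2, mul_zero]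
  rw [hz, intervalIntegral.integral_zero, zero_add]
  refine intervalIntegral.integral_congr fun s hs => ?_
  rw [uIcc_of_le h1] at hs
  rw [kernel_eq h0 (by linarith [pi_pos, hs.2]) hs.1]

/-- Proper distance in the coordinates `A = a τ` and `θ = arcsin (a t₀ / A)`. -/
noncomputable def dist (b₁ : ℝ → ℝ) (A θ : ℝ) : ℝ := ∫ s in θ..π / 2, flux b₁ (A * sin s)

/-- The derivative of `dist` with respect to `A`. -/
noncomputable def distDeriv (b₁ b₂ : ℝ → ℝ) (A θ : ℝ) : ℝ :=
  ∫ s in θ..π / 2, (flux b₁ (A * sin s) + bend b₂ (A * sin s)) / A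

/-- The function `f` in the coordinates `(A, θ)` for `0 ≤ θ`. -/
noncomputable def lapse (b₂ : ℝ → ℝ) (A θ : ℝ) : ℝ :=
  -∫ s in (0 : ℝ)..π / 2, bend b₂ (A * sin s) / A * kernel θ s

/-- The derivative of `lapse` with respect to `A`. -/
noncomputable def lapseDeriv (b₂ b₃ : ℝ → ℝ) (A θ : ℝ) : ℝ :=
  -∫ s in (0 : ℝ)..π / 2, bendDeriv b₂ b₃ (A * sin s) / A ^ 2 * kernel θ s

/-- The derivative of `f` with respect to the proper distance in the coordinates `(A, θ)`. -/
noncomputable def slope (b₁ b₂ : ℝ → ℝ) (v A θ : ℝ) : ℝ :=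
  (1 - flux b₁ A / A * rate b₁ v (A * sin θ)) / A -
    rate b₁ v (A * sin θ) / A ^ 2 * ∫ s in |θ|..π / 2, bend b₂ (A * sin s) / (1 + |cos s|)

theorem abs_mul_sin_le {A : ℝ} (hA : 0 ≤ A) (s : ℝ) : |A * sin s| ≤ A := by
  rw [abs_mul, abs_of_nonneg hA]
  nlinarith [abs_sin_le_one s]

theorem flux_mul_sin_le (h : InverseProfile b₁ b₂ b₃ v K) {A : ℝ} (hA : 0 ≤ A) (s : ℝ) :
    flux b₁ (A * sin s) ≤ flux b₁ A := h.flux_le (abs_mul_sin_le hA s)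

theorem abs_bend_mul_sin_le (h : InverseProfile b₁ b₂ b₃ v K) {A : ℝ} (hA : 0 ≤ A) (s : ℝ) :
    |bend b₂ (A * sin s)| ≤ K * flux b₁ A :=
  (h.abs_bend_le _).trans (mul_le_mul_of_nonneg_left (h.flux_mul_sin_le hA s) h.nonneg_bound)

theorem abs_bendDeriv_mul_sin_le (h : InverseProfile b₁ b₂ b₃ v K) {A : ℝ} (hA : 0 ≤ A) (s : ℝ) :
    |bendDeriv b₂ b₃ (A * sin s)| ≤ 2 * K * flux b₁ A :=
  (h.abs_bendDeriv_le _).trans (mul_le_mul_of_nonneg_left (h.flux_mul_sin_le hA s)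
    (mul_nonneg two_pos.le h.nonneg_bound))

theorem Ioo_half_double_mem_nhds {A : ℝ} (hA : 0 < A) : Ioo (A / 2) (2 * A) ∈ 𝓝 A :=
  Ioo_mem_nhds (by linarith) (by linarith)

theorem abs_div_le_of_mem {A x y B : ℝ} (hA : 0 < A) (hx : x ∈ Ioo (A / 2) (2 * A))
    (hy : |y| ≤ B) : |y / x| ≤ B / (A / 2) := by
  have hx0 : 0 < x := by linarith [hx.1]
  rw [abs_div, abs_of_pos hx0]
  exact div_le_div₀ ((abs_nonneg y).trans hy) hy (by linarith) hx.1.le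

theorem hasDerivAt_dist (h : InverseProfile b₁ b₂ b₃ v K) {A : ℝ} (hA : 0 < A) (θ : ℝ) :
    HasDerivAt (fun A => dist b₁ A θ) (distDeriv b₁ b₂ A θ) A := by
  have c1 := h.continuous_flux
  have c2 := h.continuous_bend
  refine hasDerivAt_integral_of_bounded
    (g := fun A s => flux b₁ (A * sin s))
    -- On (A/2, 2A) monotonicity of `flux` bounds numerators by their values at 2A, and 1/x is at
    -- most 1/(A/2).
    (g' := fun A s => (flux b₁ (A * sin s) + bend b₂ (A * sin s)) / A)
    (B := flux b₁ A) (B' := ((1 + K) * flux b₁ (2 * A)) / (A / 2))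
    (Ioo_half_double_mem_nhds hA) (fun x => ?_) ?_ (fun s _ => ?_) (fun x hx s _ => ?_)
    (fun s _ x hx => h.hasDerivAt_flux_mul (by linarith [hx.1]) _)
  · exact (by fun_prop : Continuous fun s => flux b₁ (x * sin s)).measurable
  · exact (by fun_prop : Continuous fun s =>
      (flux b₁ (A * sin s) + bend b₂ (A * sin s)) / A).measurable
  · rw [abs_of_nonneg (h.flux_nonneg _)]
    exact h.flux_mul_sin_le hA.le s
  · refine abs_div_le_of_mem hA hx ?_
    have hx0 : 0 < x := by linarith [hx.1]
    have h1 : flux b₁ x ≤ flux b₁ (2 * A) := h.flux_le (by rw [abs_of_pos hx0]; exact hx.2.le)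
    have h2 := h.abs_bend_mul_sin_le hx0.le s
    have h3 := h.flux_mul_sin_le hx0.le s
    have h4 := h.flux_nonneg (x * sin s)
    have h5 := mul_le_mul_of_nonneg_left h1 h.nonneg_bound
    refine (abs_add_le _ _).trans ?_
    rw [abs_of_nonneg h4]
    linarith

theorem measurable_bend_mul_sin (h : InverseProfile b₁ b₂ b₃ v K) (A : ℝ) :
    Measurable fun s => bend b₂ (A * sin s) / A := by
  have c2 := h.continuous_bend
  exact (by fun_prop : Continuous fun s => bend b₂ (A * sin s) / A).measurable

theorem measurable_bendDeriv_mul_sin (h : InverseProfile b₁ b₂ b₃ v K) (A : ℝ) :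
    Measurable fun s => bendDeriv b₂ b₃ (A * sin s) / A ^ 2 :=
  (h.measurable_bendDeriv.comp (by fun_prop)).div_const _

theorem abs_bend_div_le (h : InverseProfile b₁ b₂ b₃ v K) {A : ℝ} (hA : 0 < A) (s : ℝ) :
    |bend b₂ (A * sin s) / A| ≤ K * flux b₁ A / A := by
  rw [abs_div, abs_of_pos hA]
  exact div_le_div_of_nonneg_right (h.abs_bend_mul_sin_le hA.le s) hA.le

theorem abs_bendDeriv_div_le (h : InverseProfile b₁ b₂ b₃ v K) {A : ℝ} (hA : 0 < A) (s : ℝ) :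
    |bendDeriv b₂ b₃ (A * sin s) / A ^ 2| ≤ 2 * K * flux b₁ A / A ^ 2 := by
  rw [abs_div, abs_of_pos (pow_pos hA 2)]
  exact div_le_div_of_nonneg_right (h.abs_bendDeriv_mul_sin_le hA.le s) (by positivity)

theorem hasDerivAt_lapse (h : InverseProfile b₁ b₂ b₃ v K) {A : ℝ} (hA : 0 < A) (θ : ℝ) :
    HasDerivAt (fun A => lapse b₂ A θ) (lapseDeriv b₂ b₃ A θ) A := by
  refine HasDerivAt.neg (hasDerivAt_integral_of_bounded
    (g := fun A s => bend b₂ (A * sin s) / A * kernel θ s)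
    (g' := fun A s => bendDeriv b₂ b₃ (A * sin s) / A ^ 2 * kernel θ s)
    (B := K * flux b₁ A / A) (B' := 2 * K * flux b₁ (2 * A) / (A / 2) ^ 2)
    (Ioo_half_double_mem_nhds hA) (fun x => (h.measurable_bend_mul_sin x).mul (measurable_kernel θ))
    ((h.measurable_bendDeriv_mul_sin A).mul (measurable_kernel θ)) (fun s hs => ?_)
    (fun x hx s hs => ?_)
    (fun s _ x hx => (h.hasDerivAt_bend_mul (by linarith [hx.1]) _).mul_const _))
  · rw [uIoc_zero_pi_div_two] at hs
    exact abs_mul_kernel_le (m := fun s => bend b₂ (A * sin s) / A) (h.abs_bend_div_le hA s) hs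
  · rw [uIoc_zero_pi_div_two] at hs
    have hx0 : 0 < x := by linarith [hx.1]
    refine abs_mul_kernel_le (m := fun s => bendDeriv b₂ b₃ (x * sin s) / x ^ 2)
      ((h.abs_bendDeriv_div_le hx0 s).trans ?_) hs
    have h1 : flux b₁ x ≤ flux b₁ (2 * A) := h.flux_le (by rw [abs_of_pos hx0]; exact hx.2.le)
    have := h.nonneg_bound
    have := h.flux_nonneg (2 * A)
    have h6 : A / 2 ≤ x := hx.1.le
    gcongr

theorem continuous_lapse (h : InverseProfile b₁ b₂ b₃ v K) {A : ℝ} (hA : 0 < A) :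
    Continuous (lapse b₂ A) :=
  (continuous_integral_kernel (h.measurable_bend_mul_sin A)
    fun s _ => h.abs_bend_div_le hA s).neg

theorem continuous_lapseDeriv_right (h : InverseProfile b₁ b₂ b₃ v K) {A : ℝ} (hA : 0 < A) :
    Continuous (lapseDeriv b₂ b₃ A) :=
  (continuous_integral_kernel (h.measurable_bendDeriv_mul_sin A)
    fun s _ => h.abs_bendDeriv_div_le hA s).neg

theorem continuous_dist (h : InverseProfile b₁ b₂ b₃ v K) :
    Continuous fun p : ℝ × ℝ => dist b₁ p.1 p.2 := by
  have c1 := h.continuous_flux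
  have : (fun p : ℝ × ℝ => dist b₁ p.1 p.2) =
      fun p : ℝ × ℝ => -∫ s in π / 2..p.2, flux b₁ (p.1 * sin s) := by
    ext p; rw [← intervalIntegral.integral_symm]; rfl
  rw [this]
  exact (intervalIntegral.continuous_parametric_intervalIntegral_of_continuous
    (f := fun (p : ℝ × ℝ) s => flux b₁ (p.1 * sin s)) (by fun_prop) continuous_snd).neg

theorem continuousOn_distDeriv (h : InverseProfile b₁ b₂ b₃ v K) :
    ContinuousOn (fun p : ℝ × ℝ => distDeriv b₁ b₂ p.1 p.2) {p | 0 < p.1} := by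
  have c1 := h.continuous_flux
  have c2 := h.continuous_bend
  have : (fun p : ℝ × ℝ => distDeriv b₁ b₂ p.1 p.2) = fun p : ℝ × ℝ =>
      -(∫ s in π / 2..p.2, (flux b₁ (p.1 * sin s) + bend b₂ (p.1 * sin s))) / p.1 := by
    ext p
    rw [← intervalIntegral.integral_symm, ← intervalIntegral.integral_div]; rfl
  rw [this]
  refine ContinuousOn.div (Continuous.continuousOn (Continuous.neg ?_)) continuousOn_fst
    fun p hp => ne_of_gt hp
  exact (intervalIntegral.continuous_parametric_intervalIntegral_of_continuous
    (f := fun (p : ℝ × ℝ) s => flux b₁ (p.1 * sin s) + bend b₂ (p.1 * sin s))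
    (by fun_prop) continuous_snd)

/-- Only continuous quantities occur in `slope`: b₁ at A sin θ enters through its reciprocal, which
has the limit v, and b₂ through `bend`. The absolute value around cos s keeps the denominator
positive for every s, so that the integrand is globally continuous. -/
theorem continuousOn_slope (h : InverseProfile b₁ b₂ b₃ v K) :
    ContinuousOn (fun p : ℝ × ℝ => slope b₁ b₂ v p.1 p.2) {p | 0 < p.1} := by
  have c1 := h.continuous_flux
  have c2 := h.continuous_bend
  have c3 := h.continuous_rate
  have c4 : Continuous fun p : ℝ × ℝ =>
      ∫ s in |p.2|..π / 2, bend b₂ (p.1 * sin s) / (1 + |cos s|) := by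
    have : (fun p : ℝ × ℝ => ∫ s in |p.2|..π / 2, bend b₂ (p.1 * sin s) / (1 + |cos s|)) =
        fun p : ℝ × ℝ => -∫ s in π / 2..|p.2|, bend b₂ (p.1 * sin s) / (1 + |cos s|) := by
      ext p; rw [← intervalIntegral.integral_symm]
    rw [this]
    refine (intervalIntegral.continuous_parametric_intervalIntegral_of_continuous
      (f := fun (p : ℝ × ℝ) s => bend b₂ (p.1 * sin s) / (1 + |cos s|)) ?_
      (continuous_abs.comp continuous_snd)).neg
    refine Continuous.div (by fun_prop) (by fun_prop) fun p => ?_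
    positivity
  have hne : ∀ p ∈ {p : ℝ × ℝ | 0 < p.1}, p.1 ≠ 0 := fun p hp => ne_of_gt hp
  have hne' : ∀ p ∈ {p : ℝ × ℝ | 0 < p.1}, p.1 ^ 2 ≠ 0 := fun p hp => pow_ne_zero 2 (hne p hp)
  have c5 : Continuous fun p : ℝ × ℝ => rate b₁ v (p.1 * sin p.2) := by fun_prop
  have c6 : Continuous fun p : ℝ × ℝ => flux b₁ p.1 := by fun_prop
  unfold slope
  exact ((continuousOn_const.sub ((c6.continuousOn.div continuousOn_fst hne).mul
    c5.continuousOn)).div continuousOn_fst hne).sub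
    ((c5.continuousOn.div (continuousOn_fst.pow 2) hne').mul c4.continuousOn)

end InverseProfile

/-! ### Formulas at positive angles, and joint continuity of the A-derivative of f. -/

namespace InverseProfile

open Real

variable {b₁ b₂ b₃ : ℝ → ℝ} {v K : ℝ}

theorem continuousOn_two (h : InverseProfile b₁ b₂ b₃ v K) : ContinuousOn b₂ (Ioi 0) :=
  fun u hu => (h.hasDerivAt_two u hu).continuousAt.continuousWithinAt

theorem sin_pos_of_mem_Icc {θ s : ℝ} (h0 : 0 < θ) (hs : s ∈ Icc θ (π / 2)) : 0 < sin s :=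
  sin_pos_of_mem ⟨h0.trans_le hs.1, hs.2⟩

theorem continuousOn_two_mul_sin (h : InverseProfile b₁ b₂ b₃ v K) {A : ℝ} (hA : 0 < A) :
    ContinuousOn (fun s => b₂ (A * sin s)) (Ioo 0 π) :=
  h.continuousOn_two.comp (by fun_prop) fun _ hs => mul_pos hA (sin_pos_of_mem_Ioo hs)

theorem continuousOn_two_Icc (h : InverseProfile b₁ b₂ b₃ v K) {A θ : ℝ} (hA : 0 < A)
    (h0 : 0 < θ) : ContinuousOn (fun s => b₂ (A * sin s)) (Icc θ (π / 2)) :=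
  (h.continuousOn_two_mul_sin hA).mono fun s hs =>
    ⟨h0.trans_le hs.1, by linarith [hs.2, pi_pos]⟩

theorem intervalIntegrable_two_mul (h : InverseProfile b₁ b₂ b₃ v K) {A θ : ℝ} (hA : 0 < A)
    (h0 : 0 < θ) (h1 : θ ≤ π / 2) {g : ℝ → ℝ} (hg : ContinuousOn g (Icc θ (π / 2))) :
    IntervalIntegrable (fun s => b₂ (A * sin s) * g s) volume θ (π / 2) := by
  refine ContinuousOn.intervalIntegrable ?_
  rw [uIcc_of_le h1]
  exact (h.continuousOn_two_Icc hA h0).mul hg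

theorem lapse_eq (h : InverseProfile b₁ b₂ b₃ v K) {A θ : ℝ} (hA : 0 < A) (h0 : 0 ≤ θ)
    (h1 : θ ≤ π / 2) :
    lapse b₂ A θ = -∫ s in θ..π / 2, A * (b₂ (A * sin s) * (cos θ - cos s)) := by
  rw [lapse, integral_kernel_eq (h.measurable_bend_mul_sin A)
    (fun s _ => h.abs_bend_div_le hA s) h0 h1]
  congr 1
  refine intervalIntegral.integral_congr_ae (.of_forall fun s hs => ?_)
  rw [uIoc_of_le h1] at hs
  have hs' := sin_pos_of_mem ⟨h0.trans_lt hs.1, hs.2⟩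
  rw [bend_of_pos (mul_pos hA hs')]
  field_simp

theorem lapseDeriv_eq (h : InverseProfile b₁ b₂ b₃ v K) {A θ : ℝ} (hA : 0 < A) (h0 : 0 ≤ θ)
    (h1 : θ ≤ π / 2) :
    lapseDeriv b₂ b₃ A θ = -∫ s in θ..π / 2,
      (b₂ (A * sin s) + A * sin s * b₃ (A * sin s)) * (cos θ - cos s) := by
  rw [lapseDeriv, integral_kernel_eq (h.measurable_bendDeriv_mul_sin A)
    (fun s _ => h.abs_bendDeriv_div_le hA s) h0 h1]
  congr 1
  refine intervalIntegral.integral_congr_ae (.of_forall fun s hs => ?_)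
  rw [uIoc_of_le h1] at hs
  have hs' := sin_pos_of_mem ⟨h0.trans_lt hs.1, hs.2⟩
  rw [bendDeriv, abs_of_pos (mul_pos hA hs')]
  field_simp

theorem intervalIntegrable_lapseDeriv (h : InverseProfile b₁ b₂ b₃ v K) {A θ : ℝ} (hA : 0 < A)
    (h0 : 0 < θ) (h1 : θ ≤ π / 2) :
    IntervalIntegrable (fun s => (b₂ (A * sin s) + A * sin s * b₃ (A * sin s)) * (cos θ - cos s))
      volume θ (π / 2) := by
  refine (intervalIntegrable_of_bounded (B := 2 * K * flux b₁ A / A ^ 2)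
    ((h.measurable_bendDeriv_mul_sin A).mul (measurable_kernel θ)) fun s hs => ?_).congr
    fun s hs => ?_
  · rw [uIoc_of_le h1] at hs
    exact abs_mul_kernel_le (m := fun s => bendDeriv b₂ b₃ (A * sin s) / A ^ 2)
      (h.abs_bendDeriv_div_le hA s) ⟨h0.trans hs.1, hs.2⟩
  · rw [uIoc_of_le h1] at hs
    have hs' := sin_pos_of_mem ⟨h0.trans hs.1, hs.2⟩
    simp only [Pi.mul_apply]
    rw [kernel_eq h0.le (by linarith [hs.2, pi_pos]) hs.1.le, bendDeriv,
      abs_of_pos (mul_pos hA hs')]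
    field_simp

/-- Split 1 = cos s + (1 - cos s) under the integral. The cosine part is exact, being (b₁(A) - b₁(A
sin θ)) / A, and in the other part 1 - cos s = sin² s / (1 + cos s) turns b₂ into `bend`. The
product with 1 / b₁(A sin θ) therefore stays bounded as θ → 0, even where the integral of b₂
diverges. -/
theorem slope_eq (h : InverseProfile b₁ b₂ b₃ v K) {A θ : ℝ} (hA : 0 < A) (h0 : 0 < θ)
    (h1 : θ ≤ π / 2) :
    slope b₁ b₂ v A θ = -(1 / b₁ (A * sin θ)) * ∫ s in θ..π / 2, b₂ (A * sin s) := by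
  have hsθ := sin_pos_of_mem ⟨h0, h1⟩
  have hX := mul_pos hA hsθ
  have e1 : ∫ s in θ..π / 2, b₂ (A * sin s) * (A * cos s) = b₁ A - b₁ (A * sin θ) := by
    have hd : ∀ s ∈ uIcc θ (π / 2), HasDerivAt (fun s => b₁ (A * sin s))
        (b₂ (A * sin s) * (A * cos s)) s := by
      intro s hs
      rw [uIcc_of_le h1] at hs
      exact (h.hasDerivAt_one _ (mul_pos hA (sin_pos_of_mem_Icc h0 hs))).comp s
        ((hasDerivAt_sin s).const_mul A)
    rw [intervalIntegral.integral_eq_sub_of_hasDerivAt hd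
      (h.intervalIntegrable_two_mul hA h0 h1 (by fun_prop))]
    simp
  have e2 : ∫ s in |θ|..π / 2, bend b₂ (A * sin s) / (1 + |cos s|) =
      A ^ 2 * ∫ s in θ..π / 2, b₂ (A * sin s) * (1 - cos s) := by
    rw [abs_of_pos h0, ← intervalIntegral.integral_const_mul]
    refine intervalIntegral.integral_congr fun s hs => ?_
    rw [uIcc_of_le h1] at hs
    have hs0 := sin_pos_of_mem_Icc h0 hs
    have hc := cos_nonneg_of_mem ⟨h0.trans_le hs.1, hs.2⟩
    have : sin s ^ 2 = (1 - cos s) * (1 + cos s) := by rw [sin_sq]; ring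
    rw [bend_of_pos (mul_pos hA hs0), abs_of_nonneg hc, mul_pow, this]
    field_simp
  have e3 : ∫ s in θ..π / 2, b₂ (A * sin s) =
      (∫ s in θ..π / 2, b₂ (A * sin s) * (A * cos s)) / A +
        ∫ s in θ..π / 2, b₂ (A * sin s) * (1 - cos s) := by
    rw [← intervalIntegral.integral_div, ← intervalIntegral.integral_add
      ((h.intervalIntegrable_two_mul hA h0 h1 (by fun_prop)).div_const A)
      (h.intervalIntegrable_two_mul hA h0 h1 (by fun_prop))]
    congr 1
    ext s
    field_simp
    ring
  rw [e3, e1, slope, e2, rate_of_pos hX, flux_of_pos hA]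
  have := h.pos _ hX
  field_simp
  ring

theorem slope_neg (A θ : ℝ) : slope b₁ b₂ v A (-θ) = slope b₁ b₂ v A θ := by
  simp [slope, rate_neg]

/-- Separating cos θ from the integral, the two boundary terms b₂(A sin θ) cos θ cancel and A sin θ
∫ b₂ remains. This is `slope` times the θ-derivative of `dist`. -/
theorem hasDerivAt_lapse_right (h : InverseProfile b₁ b₂ b₃ v K) {A θ : ℝ} (hA : 0 < A)
    (h0 : 0 < θ) (h1 : θ < π / 2) :
    HasDerivAt (lapse b₂ A) (-(flux b₁ (A * sin θ) * slope b₁ b₂ v A θ)) θ := by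
  have hX := mul_pos hA (sin_pos_of_mem ⟨h0, h1.le⟩)
  have hθ : θ ∈ Ioo 0 π := ⟨h0, by linarith [pi_pos]⟩
  have key : ∀ g : ℝ → ℝ, Continuous g →
      HasDerivAt (fun x => ∫ s in x..π / 2, b₂ (A * sin s) * g s) (-(b₂ (A * sin θ) * g θ)) θ := by
    intro g hg
    have hc : ContinuousOn (fun s => b₂ (A * sin s) * g s) (Ioo 0 π) :=
      (h.continuousOn_two_mul_sin hA).mul hg.continuousOn
    exact intervalIntegral.integral_hasDerivAt_left
      (h.intervalIntegrable_two_mul hA h0 h1.le hg.continuousOn)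
      (hc.stronglyMeasurableAtFilter isOpen_Ioo θ hθ) (hc.continuousAt (isOpen_Ioo.mem_nhds hθ))
  have k1 := key (fun _ => 1) continuous_const
  have k2 := key cos continuous_cos
  have k3 := (((hasDerivAt_cos θ).mul k1).sub k2).const_mul (-A)
  refine (k3.congr_of_eventuallyEq ?_).congr_deriv ?_
  · filter_upwards [Ioo_mem_nhds h0 h1] with x hx
    have i1 := h.intervalIntegrable_two_mul hA hx.1 hx.2.le (g := fun _ => 1) (by fun_prop)
    have i2 := h.intervalIntegrable_two_mul hA hx.1 hx.2.le (g := cos) (by fun_prop)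
    simp only [Pi.mul_apply, Pi.sub_apply]
    rw [h.lapse_eq hA hx.1.le hx.2.le, ← intervalIntegral.integral_const_mul,
      ← intervalIntegral.integral_sub (i1.const_mul _) i2, ← intervalIntegral.integral_const_mul,
      ← intervalIntegral.integral_neg]
    congr 1
    ext s
    ring
  · rw [h.slope_eq hA h0 h1.le, flux_of_pos hX]
    have := h.pos _ hX
    simp only [mul_one]
    field_simp
    ring

/-- The integrand of `lapseDeriv` after an integration by parts. -/
noncomputable def bendDefect (b₂ : ℝ → ℝ) (A s : ℝ) : ℝ :=
  (bend b₂ (A * sin s) - |sin s| * bend b₂ A) / cos s ^ 2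

/-- A Lipschitz estimate for u b₂(u) near u = A, from the bound on b₃. It makes the numerator of
`bendDefect` vanish like cos² s at s = π/2. -/
theorem abs_bend_sub_le (h : InverseProfile b₁ b₂ b₃ v K) {A c : ℝ} (hA : 0 < A) (h0 : 0 ≤ c)
    (h1 : c ≤ 1) : |bend b₂ (A * c) - c * bend b₂ A| ≤ 4 * K * flux b₁ A * (1 - c) := by
  have hK := h.nonneg_bound
  have hf := h.flux_nonneg A
  have hKf := mul_nonneg hK hf
  -- For c ≤ 1/2 the factor 1 - c is at least 1/2, so the triangle inequality suffices. For c ≥ 1/2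
  -- the mean value inequality on [Ac, A] is used, with 1/c ≤ 2.
  rcases le_total c (1 / 2) with hc | hc
  · have e1 := h.abs_bend_le A
    have e2 : |bend b₂ (A * c)| ≤ K * flux b₁ A :=
      (h.abs_bend_le _).trans (mul_le_mul_of_nonneg_left
        (h.flux_le (by rw [abs_of_nonneg (by positivity)]; nlinarith)) hK)
    refine (abs_sub _ _).trans ?_
    rw [abs_mul, abs_of_nonneg h0]
    nlinarith [abs_nonneg (bend b₂ A)]
  · have hc0 : 0 < c := by linarith
    have hAc := mul_pos hA hc0
    have hsub : A * c ≤ A := by nlinarith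
    have hd : ∀ x ∈ Icc (A * c) A, HasDerivWithinAt (fun u => bend b₂ (u * 1) / u)
        (bendDeriv b₂ b₃ (x * 1) / x ^ 2) (Icc (A * c) A) x := fun x hx =>
      (h.hasDerivAt_bend_mul (hAc.trans_le hx.1) 1).hasDerivWithinAt
    have hb : ∀ x ∈ Icc (A * c) A, ‖bendDeriv b₂ b₃ (x * 1) / x ^ 2‖ ≤
        2 * K * flux b₁ A / (A * c) ^ 2 := by
      intro x hx
      have hx0 := hAc.trans_le hx.1
      rw [mul_one, norm_eq_abs, abs_div, abs_of_pos (pow_pos hx0 2)]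
      have e1 := h.abs_bendDeriv_le x
      have e2 : flux b₁ x ≤ flux b₁ A := h.flux_le (by rw [abs_of_pos hx0]; exact hx.2)
      have e3 : |bendDeriv b₂ b₃ x| ≤ 2 * K * flux b₁ A := e1.trans (by gcongr)
      have e4 := hx.1
      gcongr
    have := (convex_Icc (A * c) A).norm_image_sub_le_of_norm_hasDerivWithin_le hd hb
      (right_mem_Icc.2 hsub) (left_mem_Icc.2 hsub)
    simp only [mul_one, norm_eq_abs] at this
    have e5 : bend b₂ (A * c) - c * bend b₂ A =
        A * c * (bend b₂ (A * c) / (A * c) - bend b₂ A / A) := by field_simp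
    have e6 : |A * c - A| = A * (1 - c) := by
      rw [abs_of_nonpos (by linarith)]; ring
    rw [e5, abs_mul, abs_of_pos hAc]
    calc _ ≤ A * c * (2 * K * flux b₁ A / (A * c) ^ 2 * |A * c - A|) := by gcongr
      _ = 2 * K * flux b₁ A * (1 - c) * (1 / c) := by rw [e6]; field_simp
      _ ≤ 2 * K * flux b₁ A * (1 - c) * 2 := by
        have : 1 / c ≤ 2 := by rw [div_le_iff₀ hc0]; linarith
        have : 0 ≤ 1 - c := by linarith
        gcongr
      _ = _ := by ring

theorem abs_bendDefect_mul_le (h : InverseProfile b₁ b₂ b₃ v K) {A : ℝ} (hA : 0 < A) (s : ℝ) :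
    |bend b₂ (A * sin s) - |sin s| * bend b₂ A| ≤ 4 * K * flux b₁ A * cos s ^ 2 := by
  have e : bend b₂ (A * sin s) = bend b₂ (A * |sin s|) := by
    rcases abs_choice (sin s) with hs | hs <;> rw [hs]
    rw [mul_neg, bend_neg]
  rw [e]
  have h1 := abs_sin_le_one s
  have h0 := abs_nonneg (sin s)
  refine (h.abs_bend_sub_le hA h0 h1).trans ?_
  have := mul_nonneg h.nonneg_bound (h.flux_nonneg A)
  -- Because cos² s = (1 - |sin s|)(1 + |sin s|).
  have hc : 1 - |sin s| ≤ cos s ^ 2 := by rw [cos_sq', ← sq_abs (sin s)]; nlinarith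
  exact mul_le_mul_of_nonneg_left hc (by linarith)

theorem abs_bendDefect_le (h : InverseProfile b₁ b₂ b₃ v K) {A : ℝ} (hA : 0 < A) (s : ℝ) :
    |bendDefect b₂ A s| ≤ 4 * K * flux b₁ A := by
  have hK := mul_nonneg h.nonneg_bound (h.flux_nonneg A)
  rw [bendDefect, abs_div, abs_of_nonneg (sq_nonneg (cos s))]
  exact div_le_of_le_mul₀ (sq_nonneg _) (by linarith) (h.abs_bendDefect_mul_le hA s)

theorem measurable_bendDefect (h : InverseProfile b₁ b₂ b₃ v K) (A : ℝ) :
    Measurable (bendDefect b₂ A) := by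
  have c := h.continuous_bend
  unfold bendDefect
  exact (by fun_prop : Continuous fun s => bend b₂ (A * sin s) - |sin s| * bend b₂ A).measurable.div
    (by fun_prop)

theorem continuousAt_integral_bendDefect (h : InverseProfile b₁ b₂ b₃ v K) {A θ : ℝ} (hA : 0 < A)
    (h0 : 0 ≤ θ) (h1 : θ < π / 2) :
    ContinuousAt (fun p : ℝ × ℝ => ∫ s in p.2..π / 2, bendDefect b₂ p.1 s) (A, θ) := by
  have c := h.continuous_bend
  have : (fun p : ℝ × ℝ => ∫ s in p.2..π / 2, bendDefect b₂ p.1 s) =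
      fun p : ℝ × ℝ => -∫ s in π / 2..p.2, bendDefect b₂ p.1 s := by
    ext p; rw [← intervalIntegral.integral_symm]
  rw [this]
  -- The interval (-1, π) is any one containing both θ and π/2 in its interior; the bound on
  -- `bendDefect` holds for all s.
  refine (intervalIntegral.continuousAt_parametric_primitive_of_dominated
    (fun _ => 4 * K * flux b₁ (2 * A)) (-1) π
    (fun x => (h.measurable_bendDefect x).aestronglyMeasurable) ?_ intervalIntegrable_const
    (.of_forall fun s => ?_) ?_ ?_ (by simp)).neg
  · filter_upwards [Ioo_half_double_mem_nhds hA] with x hx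
    refine .of_forall fun s => ?_
    have hx0 : 0 < x := by linarith [hx.1]
    have e2 : flux b₁ x ≤ flux b₁ (2 * A) := h.flux_le (by rw [abs_of_pos hx0]; exact hx.2.le)
    have := h.nonneg_bound
    exact (h.abs_bendDefect_le hx0 s).trans (by gcongr)
  · unfold bendDefect
    exact (by fun_prop : Continuous fun x =>
      (bend b₂ (x * sin s) - |sin s| * bend b₂ x) / cos s ^ 2).continuousAt
  · constructor <;> linarith [pi_pos]
  · constructor <;> linarith [pi_pos]

/-- Integration by parts against d(u b₂(u)) = (b₂ + u b₃) du. The primitive of b₂ + u b₃ is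
normalized to vanish at u = A and is multiplied by cos θ / cos s - 1, which vanishes at s = θ; so
both boundary terms disappear, and what is left involves b₂ only. -/
theorem lapseDeriv_eq_of_pos (h : InverseProfile b₁ b₂ b₃ v K) {A θ : ℝ} (hA : 0 < A)
    (h0 : 0 < θ) (h1 : θ < π / 2) :
    lapseDeriv b₂ b₃ A θ = cos θ / A ^ 2 * ∫ s in θ..π / 2, bendDefect b₂ A s := by
  set G : ℝ → ℝ := fun s =>
    (bend b₂ (A * sin s) / (A * sin s) - bend b₂ A / A) * (cos θ / cos s - 1) with hG
  set G' : ℝ → ℝ := fun s =>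
    A * ((b₂ (A * sin s) + A * sin s * b₃ (A * sin s)) * (cos θ - cos s)) +
      cos θ / A * bendDefect b₂ A s with hG'
  have hcos : ∀ s ∈ Ico θ (π / 2), 0 < cos s := fun s hs =>
    cos_pos_of_mem_Ioo ⟨by linarith [pi_pos, hs.1], hs.2⟩
  have hd : ∀ s ∈ Ico θ (π / 2), HasDerivAt G (G' s) s := by
    intro s hs
    have hsin := sin_pos_of_mem_Icc h0 ⟨hs.1, hs.2.le⟩
    have hc := hcos s hs
    have hu := mul_pos hA hsin
    have d1 := ((h.hasDerivAt_bend_mul hu 1).comp s ((hasDerivAt_sin s).const_mul A)).sub_const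
      (bend b₂ A / A)
    have d2 := (((hasDerivAt_const s (cos θ)).div (hasDerivAt_cos s) hc.ne').sub_const 1)
    have d3 := d1.mul d2
    refine (d3.congr_of_eventuallyEq ?_).congr_deriv ?_
    · exact .of_forall fun x => by simp [hG]
    · simp only [hG', bendDefect, Function.comp, mul_one, bendDeriv, abs_of_pos hu, abs_of_pos hsin,
        bend_of_pos hu]
      simp
      field_simp
  have hi1 := (h.intervalIntegrable_lapseDeriv hA h0 h1.le).const_mul A
  have hi2 : IntervalIntegrable (bendDefect b₂ A) volume θ (π / 2) :=
    intervalIntegrable_of_bounded (h.measurable_bendDefect A) fun s _ => h.abs_bendDefect_le hA s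
  -- At π/2 the second factor of G blows up like 1 / cos s, but the first is O(cos² s). The division
  -- convention 1/0 = 0 agrees with the limit, since G(π/2) = 0 through the first factor.
  have hcont : ContinuousOn G (Icc θ (π / 2)) := by
    intro s hs
    rcases hs.2.eq_or_lt with rfl | hlt
    · have hz : G (π / 2) = 0 := by simp [hG]
      rw [ContinuousWithinAt, hz]
      have hb : ∀ s ∈ Icc θ (π / 2), ‖G s‖ ≤ 4 * K * flux b₁ A / (A * sin θ) * cos s := by
        intro s hs
        rcases hs.2.eq_or_lt with rfl | hlt
        · simp [hG]
        have hc := hcos s ⟨hs.1, hlt⟩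
        have hsin := sin_pos_of_mem_Icc h0 hs
        have hsθ := sin_pos_of_mem ⟨h0, h1.le⟩
        have hle : sin θ ≤ sin s := sin_le_sin_of_le_of_le_pi_div_two (by linarith [pi_pos]) hs.2 hs.1
        have e : G s = (bend b₂ (A * sin s) - |sin s| * bend b₂ A) * (cos θ - cos s) /
            (A * sin s * cos s) := by
          simp only [hG, abs_of_pos hsin]; field_simp
        have e1 := h.abs_bendDefect_mul_le hA s
        have e2 : |cos θ - cos s| ≤ 1 := by
          have := cos_le_cos_of_nonneg_of_le_pi h0.le (by linarith [pi_pos, hs.2]) hs.1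
          rw [abs_of_nonneg (by linarith)]
          linarith [cos_le_one θ]
        have hK : 0 ≤ 4 * K * flux b₁ A :=
          mul_nonneg (mul_nonneg (by norm_num) h.nonneg_bound) (h.flux_nonneg A)
        rw [e, norm_eq_abs, abs_div, abs_of_pos (by positivity : 0 < A * sin s * cos s), abs_mul]
        calc _ ≤ 4 * K * flux b₁ A * cos s ^ 2 * 1 / (A * sin s * cos s) := by gcongr
          _ = 4 * K * flux b₁ A / (A * sin s) * cos s := by field_simp
          _ ≤ _ := by gcongr
      refine squeeze_zero_norm' (eventually_nhdsWithin_of_forall hb) ?_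
      have := ((continuous_cos.const_mul (4 * K * flux b₁ A / (A * sin θ))).tendsto (π / 2)).mono_left
        (nhdsWithin_le_nhds (s := Icc θ (π / 2)))
      simpa using this
    · exact (hd s ⟨hs.1, hlt⟩).continuousAt.continuousWithinAt
  have key := intervalIntegral.integral_eq_sub_of_hasDerivAt_of_le h1.le hcont
    (fun s hs => hd s ⟨hs.1.le, hs.2⟩) (hi1.add (hi2.const_mul (cos θ / A)))
  have z1 : G (π / 2) = 0 := by simp [hG]
  have z2 : G θ = 0 := by simp [hG, (hcos θ ⟨le_rfl, h1⟩).ne']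
  rw [z1, z2, intervalIntegral.integral_add hi1 (hi2.const_mul _),
    intervalIntegral.integral_const_mul, intervalIntegral.integral_const_mul] at key
  rw [h.lapseDeriv_eq hA h0.le h1.le]
  field_simp
  field_simp at key
  linarith

/-- At θ = 0 the boundary argument is unavailable because b₂ may be singular there; both sides are
continuous in θ, so the identity passes to the limit. -/
theorem lapseDeriv_eq_bendDefect (h : InverseProfile b₁ b₂ b₃ v K) {A θ : ℝ} (hA : 0 < A)
    (h0 : 0 ≤ θ) (h1 : θ < π / 2) :
    lapseDeriv b₂ b₃ A θ = cos θ / A ^ 2 * ∫ s in θ..π / 2, bendDefect b₂ A s := by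
  rcases h0.eq_or_lt with rfl | h0
  · have t1 := ((h.continuous_lapseDeriv_right hA).tendsto 0).mono_left
      (nhdsWithin_le_nhds (s := Ioi 0))
    have c1 : ContinuousAt (fun θ => cos θ / A ^ 2 * ∫ s in θ..π / 2, bendDefect b₂ A s) 0 := by
      have : ContinuousAt (fun θ => ∫ s in θ..π / 2, bendDefect b₂ A s) 0 :=
        (h.continuousAt_integral_bendDefect hA h0 h1).comp
          (f := fun θ : ℝ => (A, θ)) (by fun_prop)
      fun_prop
    have t2 := c1.tendsto.mono_left (nhdsWithin_le_nhds (s := Ioi 0))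
    refine tendsto_nhds_unique t1 (t2.congr' ?_)
    filter_upwards [Ioo_mem_nhdsGT h1] with x hx
    exact (h.lapseDeriv_eq_of_pos hA hx.1 hx.2).symm
  · exact h.lapseDeriv_eq_of_pos hA h0 h1

theorem continuousOn_lapseDeriv (h : InverseProfile b₁ b₂ b₃ v K) :
    ContinuousOn (fun p : ℝ × ℝ => lapseDeriv b₂ b₃ p.1 p.2) (Ioi 0 ×ˢ Ico 0 (π / 2)) := by
  rintro ⟨A, θ⟩ ⟨hA, h0, h1⟩
  have hA' : 0 < A := hA
  have c : ContinuousAt (fun p : ℝ × ℝ => cos p.2 / p.1 ^ 2 *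
      ∫ s in p.2..π / 2, bendDefect b₂ p.1 s) (A, θ) := by
    refine ContinuousAt.mul ?_ (h.continuousAt_integral_bendDefect hA h0 h1)
    exact ContinuousAt.div (by fun_prop) (by fun_prop) (pow_ne_zero 2 hA'.ne')
  refine c.continuousWithinAt.congr (fun p hp => ?_) ?_
  · exact h.lapseDeriv_eq_bendDefect hp.1 hp.2.1 hp.2.2
  · exact h.lapseDeriv_eq_bendDefect hA h0 h1

end InverseProfile

/-! ### Crossing the big bang: differentiability of f in the coordinates (A, ρ). -/

namespace InverseProfile

open Real

variable {b₁ b₂ b₃ : ℝ → ℝ} {v K : ℝ}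

/-- The extension of `F` from nonnegative angles by reflection through `(0, F 0)`. -/
noncomputable def reflect (F : ℝ → ℝ) (θ : ℝ) : ℝ := F (max θ 0) + F 0 - F (max (-θ) 0)

theorem reflect_of_nonneg (F : ℝ → ℝ) {θ : ℝ} (hθ : 0 ≤ θ) : reflect F θ = F θ := by
  simp [reflect, hθ]

theorem reflect_of_nonpos (F : ℝ → ℝ) {θ : ℝ} (hθ : θ ≤ 0) :
    reflect F θ = 2 * F 0 - F (-θ) := by
  simp [reflect, hθ]; ring

theorem continuous_reflect {F : ℝ → ℝ} (hF : Continuous F) : Continuous (reflect F) := by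
  unfold reflect; fun_prop

theorem hasDerivAt_reflect_lapse (h : InverseProfile b₁ b₂ b₃ v K) {A : ℝ} (hA : 0 < A) (θ : ℝ) :
    HasDerivAt (fun A => reflect (lapse b₂ A) θ) (reflect (lapseDeriv b₂ b₃ A) θ) A :=
  ((h.hasDerivAt_lapse hA _).add (h.hasDerivAt_lapse hA _)).sub (h.hasDerivAt_lapse hA _)

theorem hasDerivAt_reflect_lapse_right (h : InverseProfile b₁ b₂ b₃ v K) {A θ : ℝ} (hA : 0 < A)
    (hθ : θ ∈ Ioo (-(π / 2)) (π / 2)) (h0 : θ ≠ 0) :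
    HasDerivAt (reflect (lapse b₂ A)) (-(flux b₁ (A * sin θ) * slope b₁ b₂ v A θ)) θ := by
  rcases h0.lt_or_gt with h0 | h0
  · have d := (h.hasDerivAt_lapse_right hA (neg_pos.2 h0) (by linarith [hθ.1])).comp θ
      (hasDerivAt_neg θ)
    refine ((d.const_sub (2 * lapse b₂ A 0)).congr_of_eventuallyEq ?_).congr_deriv ?_
    · filter_upwards [gt_mem_nhds h0] with x hx using reflect_of_nonpos _ hx.le
    · rw [slope_neg, sin_neg, mul_neg A, flux_neg]; ring
  · refine (h.hasDerivAt_lapse_right hA h0 hθ.2).congr_of_eventuallyEq ?_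
    filter_upwards [lt_mem_nhds h0] with x hx using reflect_of_nonneg _ hx.le

theorem continuousAt_reflect_lapseDeriv (h : InverseProfile b₁ b₂ b₃ v K) {A θ : ℝ} (hA : 0 < A)
    (hθ : θ ∈ Ioo (-(π / 2)) (π / 2)) :
    ContinuousAt (fun p : ℝ × ℝ => reflect (lapseDeriv b₂ b₃ p.1) p.2) (A, θ) := by
  have key : ∀ g : ℝ → ℝ, Continuous g → (∀ x ∈ Ioo (-(π / 2)) (π / 2), g x ∈ Ico 0 (π / 2)) →
      ContinuousAt (fun p : ℝ × ℝ => lapseDeriv b₂ b₃ p.1 (g p.2)) (A, θ) := by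
    intro g hg hm
    have c : ContinuousOn (fun p : ℝ × ℝ => lapseDeriv b₂ b₃ p.1 (g p.2))
        (Ioi 0 ×ˢ Ioo (-(π / 2)) (π / 2)) :=
      h.continuousOn_lapseDeriv.comp (f := fun p : ℝ × ℝ => (p.1, g p.2)) (by fun_prop)
        fun p hp => ⟨hp.1, hm _ hp.2⟩
    exact c.continuousAt ((isOpen_Ioi.prod isOpen_Ioo).mem_nhds ⟨hA, hθ⟩)
  have hpi := pi_pos
  refine ((key (fun x => max x 0) (by fun_prop) fun x hx => ?_).add
    (key (fun _ => 0) (by fun_prop) fun x hx => ?_)).sub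
    (key (fun x => max (-x) 0) (by fun_prop) fun x hx => ?_)
  · exact ⟨le_max_right _ _, max_lt hx.2 (by positivity)⟩
  · exact ⟨le_rfl, by positivity⟩
  · exact ⟨le_max_right _ _, max_lt (by linarith [hx.1]) (by positivity)⟩

theorem dist_sub_dist (h : InverseProfile b₁ b₂ b₃ v K) (A θ₁ θ₂ : ℝ) :
    dist b₁ A θ₁ - dist b₁ A θ₂ = ∫ s in θ₁..θ₂, flux b₁ (A * sin s) := by
  have c := h.continuous_flux
  have hi : ∀ x y, IntervalIntegrable (fun s => flux b₁ (A * sin s)) volume x y :=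
    fun x y => (by fun_prop : Continuous fun s => flux b₁ (A * sin s)).intervalIntegrable x y
  rw [dist, dist, ← intervalIntegral.integral_add_adjacent_intervals (hi θ₁ θ₂) (hi θ₂ _),
    add_sub_cancel_right]

/-- No derivative at θ = 0 is needed: the fundamental theorem of calculus tolerates one exceptional
point when the primitive is continuous and the candidate derivative is integrable. -/
theorem reflect_lapse_sub (h : InverseProfile b₁ b₂ b₃ v K) {A θ₁ θ₂ : ℝ} (hA : 0 < A)
    (h₁ : θ₁ ∈ Ioo (-(π / 2)) (π / 2)) (h₂ : θ₂ ∈ Ioo (-(π / 2)) (π / 2)) :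
    reflect (lapse b₂ A) θ₁ - reflect (lapse b₂ A) θ₂ =
      ∫ s in θ₁..θ₂, flux b₁ (A * sin s) * slope b₁ b₂ v A s := by
  have c := h.continuous_flux
  have cs : Continuous (slope b₁ b₂ v A) :=
    h.continuousOn_slope.comp_continuous (f := fun θ : ℝ => (A, θ)) (by fun_prop) fun _ => hA
  have hsub : uIcc θ₁ θ₂ ⊆ Ioo (-(π / 2)) (π / 2) := ordConnected_Ioo.uIcc_subset h₁ h₂
  have key := MeasureTheory.integral_eq_of_hasDerivAt_off_countable (reflect (lapse b₂ A))
    (fun θ => -(flux b₁ (A * sin θ) * slope b₁ b₂ v A θ)) (a := θ₁) (b := θ₂) (countable_singleton 0)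
    (continuous_reflect (h.continuous_lapse hA)).continuousOn
    (fun x hx => h.hasDerivAt_reflect_lapse_right hA
      (hsub (Ioo_subset_Icc_self hx.1)) hx.2)
    ((by fun_prop : Continuous fun θ =>
      -(flux b₁ (A * sin θ) * slope b₁ b₂ v A θ)).intervalIntegrable _ _)
  rw [intervalIntegral.integral_neg] at key
  linarith

/-- The integrand is nonnegative and vanishes only at the angle 0, hence strictness survives
although the derivative is zero there. -/
theorem dist_strictAntiOn (h : InverseProfile b₁ b₂ b₃ v K) {A : ℝ} (hA : 0 < A) :
    StrictAntiOn (dist b₁ A) (Icc (-(π / 2)) (π / 2)) := by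
  intro x hx y hy hxy
  have c := h.continuous_flux
  rw [← sub_pos, h.dist_sub_dist]
  have hpi := pi_pos
  have hsin : ∀ z ∈ Icc (-(π / 2)) (π / 2), z ≠ 0 → 0 < flux b₁ (A * sin z) := fun z hz hz0 =>
    h.flux_pos (mul_ne_zero hA.ne' fun hs =>
      hz0 ((sin_eq_zero_iff_of_lt_of_lt (by linarith [hz.1]) (by linarith [hz.2])).1 hs))
  refine intervalIntegral.integral_pos hxy
    (by fun_prop : Continuous fun s => flux b₁ (A * sin s)).continuousOn
    (fun s _ => h.flux_nonneg _) ?_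
  rcases eq_or_ne x 0 with rfl | hx0
  · exact ⟨y, right_mem_Icc.2 hxy.le, hsin y hy hxy.ne'⟩
  · exact ⟨x, left_mem_Icc.2 hxy.le, hsin x hx hx0⟩

theorem dist_pi_div_two (A : ℝ) : dist b₁ A (π / 2) = 0 := intervalIntegral.integral_same

theorem integral_neg_eq_of_even {g : ℝ → ℝ} (hg : ∀ s, g (-s) = g s) (x : ℝ) :
    ∫ s in (0 : ℝ)..-x, g s = -∫ s in (0 : ℝ)..x, g s := by
  have := intervalIntegral.integral_comp_neg (f := g) (a := x) (b := 0)
  simp only [hg, neg_zero] at this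
  rw [← this, intervalIntegral.integral_symm]

theorem dist_neg (h : InverseProfile b₁ b₂ b₃ v K) (A θ : ℝ) :
    dist b₁ A (-θ) = 2 * dist b₁ A 0 - dist b₁ A θ := by
  have h1 := h.dist_sub_dist A 0 θ
  have h2 := h.dist_sub_dist A 0 (-θ)
  rw [integral_neg_eq_of_even fun s => by rw [sin_neg, mul_neg, flux_neg]] at h2
  linarith

/-- The image of the domain of the chart in the coordinates `(A, ρ)`. -/
def region (b₁ : ℝ → ℝ) : Set (ℝ × ℝ) := {p | 0 < p.1 ∧ 0 < p.2 ∧ p.2 < 2 * dist b₁ p.1 0}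

theorem isOpen_region (h : InverseProfile b₁ b₂ b₃ v K) : IsOpen (region b₁) := by
  have c : Continuous fun p : ℝ × ℝ => dist b₁ p.1 0 :=
    h.continuous_dist.comp (f := fun p : ℝ × ℝ => (p.1, 0)) (by fun_prop)
  exact (isOpen_lt continuous_const continuous_fst).inter
    ((isOpen_lt continuous_const continuous_snd).inter
      (isOpen_lt continuous_snd (continuous_const.mul c)))

theorem exists_angle (h : InverseProfile b₁ b₂ b₃ v K) {p : ℝ × ℝ} (hp : p ∈ region b₁) :
    ∃ θ, θ ∈ Ioo (-(π / 2)) (π / 2) ∧ dist b₁ p.1 θ = p.2 := by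
  have c : Continuous (dist b₁ p.1) :=
    h.continuous_dist.comp (f := fun θ : ℝ => (p.1, θ)) (by fun_prop)
  have hpi : -(π / 2) ≤ π / 2 := by linarith [pi_pos]
  have := intermediate_value_Ioo' hpi c.continuousOn
  rw [h.dist_neg, dist_pi_div_two, sub_zero] at this
  exact this ⟨hp.2.1, hp.2.2⟩

/-- The angle at proper distance `ρ`. -/
noncomputable def angle (b₁ : ℝ → ℝ) (p : ℝ × ℝ) : ℝ :=
  Classical.epsilon fun θ => θ ∈ Ioo (-(π / 2)) (π / 2) ∧ dist b₁ p.1 θ = p.2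

theorem angle_mem (h : InverseProfile b₁ b₂ b₃ v K) {p : ℝ × ℝ} (hp : p ∈ region b₁) :
    angle b₁ p ∈ Ioo (-(π / 2)) (π / 2) := (Classical.epsilon_spec (h.exists_angle hp)).1

theorem dist_angle (h : InverseProfile b₁ b₂ b₃ v K) {p : ℝ × ℝ} (hp : p ∈ region b₁) :
    dist b₁ p.1 (angle b₁ p) = p.2 := (Classical.epsilon_spec (h.exists_angle hp)).2

theorem angle_eq (h : InverseProfile b₁ b₂ b₃ v K) {p : ℝ × ℝ} (hp : p ∈ region b₁) {θ : ℝ}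
    (hθ : θ ∈ Ioo (-(π / 2)) (π / 2)) (hd : dist b₁ p.1 θ = p.2) : angle b₁ p = θ :=
  (h.dist_strictAntiOn hp.1).injOn (Ioo_subset_Icc_self (h.angle_mem hp))
    (Ioo_subset_Icc_self hθ) ((h.dist_angle hp).trans hd.symm)

/-- By monotonicity, the angle exceeds c exactly when ρ < P(A, c), an open condition in (A, ρ) as P
is continuous in A; similarly from the other side. The thresholds are clamped to [-π/2, π/2], where
monotonicity holds. -/
theorem continuousAt_angle (h : InverseProfile b₁ b₂ b₃ v K) {p : ℝ × ℝ} (hp : p ∈ region b₁) :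
    ContinuousAt (angle b₁) p := by
  have hm := h.angle_mem hp
  have hd := h.dist_angle hp
  have hpi := pi_pos
  have hc : ∀ c, Continuous fun q : ℝ × ℝ => dist b₁ q.1 c := fun c =>
    h.continuous_dist.comp (f := fun p : ℝ × ℝ => (p.1, c)) (by fun_prop)
  refine tendsto_order.2 ⟨fun c hcl => ?_, fun c hcl => ?_⟩
  · have hc' : max c (-(π / 2)) < angle b₁ p := max_lt hcl hm.1
    have hI : max c (-(π / 2)) ∈ Icc (-(π / 2)) (π / 2) :=
      ⟨le_max_right _ _, hc'.le.trans hm.2.le⟩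
    have hlt := h.dist_strictAntiOn hp.1 hI (Ioo_subset_Icc_self hm) hc'
    rw [hd] at hlt
    filter_upwards [h.isOpen_region.mem_nhds hp,
      (isOpen_lt continuous_snd (hc (max c (-(π / 2))))).mem_nhds hlt] with q hq hqlt
    refine (le_max_left c (-(π / 2))).trans_lt (not_le.1 fun hle => ?_)
    have := (h.dist_strictAntiOn hq.1).antitoneOn (Ioo_subset_Icc_self (h.angle_mem hq)) hI hle
    rw [h.dist_angle hq] at this
    exact absurd hqlt (not_lt.2 this)
  · have hc' : angle b₁ p < min c (π / 2) := lt_min hcl hm.2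
    have hI : min c (π / 2) ∈ Icc (-(π / 2)) (π / 2) :=
      ⟨hm.1.le.trans hc'.le, min_le_right _ _⟩
    have hlt := h.dist_strictAntiOn hp.1 (Ioo_subset_Icc_self hm) hI hc'
    rw [hd] at hlt
    filter_upwards [h.isOpen_region.mem_nhds hp,
      (isOpen_lt (hc (min c (π / 2))) continuous_snd).mem_nhds hlt] with q hq hqlt
    refine lt_of_lt_of_le (not_le.1 fun hle => ?_) (min_le_left c (π / 2))
    have := (h.dist_strictAntiOn hq.1).antitoneOn hI (Ioo_subset_Icc_self (h.angle_mem hq)) hle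
    rw [h.dist_angle hq] at this
    exact absurd hqlt (not_lt.2 this)

/-- The increments of f and of the distance are integrals of `flux` times `slope` and of `flux`. On
a small ball `slope` is within ε of its central value, and since `flux` has a constant sign the
error is at most ε times the absolute increment of distance. This replaces division by the vanishing
derivative of the distance. -/
theorem eventually_abs_reflect_lapse_sub_le (h : InverseProfile b₁ b₂ b₃ v K) {A θ : ℝ}
    (hA : 0 < A) (hθ : θ ∈ Ioo (-(π / 2)) (π / 2)) {ε : ℝ} (hε : 0 < ε) :
    ∀ᶠ p : ℝ × ℝ in 𝓝 (A, θ),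
      |reflect (lapse b₂ p.1) p.2 - reflect (lapse b₂ p.1) θ -
        slope b₁ b₂ v A θ * (dist b₁ p.1 p.2 - dist b₁ p.1 θ)| ≤
      ε * |dist b₁ p.1 p.2 - dist b₁ p.1 θ| := by
  have c := h.continuous_flux
  have hopen : IsOpen {p : ℝ × ℝ | 0 < p.1} := isOpen_lt continuous_const continuous_fst
  have hs : ContinuousAt (fun p : ℝ × ℝ => slope b₁ b₂ v p.1 p.2) (A, θ) :=
    h.continuousOn_slope.continuousAt (hopen.mem_nhds hA)
  obtain ⟨δ, hδ, hball⟩ := Metric.eventually_nhds_iff_ball.1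
    ((Metric.tendsto_nhds.1 hs ε hε).and ((show ∀ᶠ p : ℝ × ℝ in 𝓝 (A, θ), 0 < p.1 from hopen.mem_nhds hA).and
      (show ∀ᶠ p : ℝ × ℝ in 𝓝 (A, θ), p.2 ∈ Ioo (-(π / 2)) (π / 2) from
        continuousAt_snd.eventually (isOpen_Ioo.mem_nhds hθ))))
  refine Metric.eventually_nhds_iff_ball.2 ⟨δ, hδ, fun p hp => ?_⟩
  obtain ⟨-, hp0, hpm⟩ := hball p hp
  rw [← ball_prod_same] at hp hball
  have cs : Continuous (slope b₁ b₂ v p.1) :=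
    h.continuousOn_slope.comp_continuous (f := fun θ : ℝ => (p.1, θ)) (by fun_prop) fun _ => hp0
  rw [h.reflect_lapse_sub hp0 hpm hθ, h.dist_sub_dist, ← intervalIntegral.integral_const_mul,
    ← intervalIntegral.integral_sub
      ((by fun_prop : Continuous fun s => flux b₁ (p.1 * sin s) * slope b₁ b₂ v p.1 s).intervalIntegrable _ _)
      ((by fun_prop : Continuous fun s => slope b₁ b₂ v A θ * flux b₁ (p.1 * sin s)).intervalIntegrable _ _)]
  have hb : ∀ s ∈ uIoc p.2 θ, ‖flux b₁ (p.1 * sin s) * slope b₁ b₂ v p.1 s -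
      slope b₁ b₂ v A θ * flux b₁ (p.1 * sin s)‖ ≤ ε * flux b₁ (p.1 * sin s) := by
    intro s hs
    have hs' : s ∈ Metric.ball θ δ :=
      (convex_ball θ δ).ordConnected.uIcc_subset hp.2 (Metric.mem_ball_self hδ)
        (uIoc_subset_uIcc hs)
    have h1 := (hball (p.1, s) ⟨hp.1, hs'⟩).1
    rw [Real.dist_eq] at h1
    have h2 := h.flux_nonneg (p.1 * sin s)
    have e : flux b₁ (p.1 * sin s) * slope b₁ b₂ v p.1 s -
      slope b₁ b₂ v A θ * flux b₁ (p.1 * sin s) =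
      (slope b₁ b₂ v p.1 s - slope b₁ b₂ v A θ) * flux b₁ (p.1 * sin s) := by ring
    rw [e, norm_eq_abs, abs_mul, abs_of_nonneg h2]
    exact mul_le_mul_of_nonneg_right h1.le h2
  have := intervalIntegral.norm_integral_le_abs_of_norm_le (μ := volume)
    ((ae_restrict_iff' measurableSet_uIoc).2 (.of_forall hb))
    ((by fun_prop : Continuous fun s => ε * flux b₁ (p.1 * sin s)).intervalIntegrable _ _)
  rw [intervalIntegral.integral_const_mul, abs_mul, abs_of_pos hε] at this
  exact this

/-- The function `𝐟` in the coordinates `(A, ρ)`. -/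
noncomputable def potential (b₁ b₂ : ℝ → ℝ) (p : ℝ × ℝ) : ℝ := reflect (lapse b₂ p.1) (angle b₁ p)

theorem hasFDerivAt_potential (h : InverseProfile b₁ b₂ b₃ v K) {p : ℝ × ℝ} (hp : p ∈ region b₁) :
    HasFDerivAt (potential b₁ b₂)
      ((reflect (lapseDeriv b₂ b₃ p.1) (angle b₁ p) -
          slope b₁ b₂ v p.1 (angle b₁ p) * distDeriv b₁ b₂ p.1 (angle b₁ p)) •
        ContinuousLinearMap.fst ℝ ℝ ℝ +
        slope b₁ b₂ v p.1 (angle b₁ p) • ContinuousLinearMap.snd ℝ ℝ ℝ) p := by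
  have hA : 0 < p.1 := hp.1
  have hm := h.angle_mem hp
  set θ := angle b₁ p with hθ
  set Q := slope b₁ b₂ v p.1 θ
  have hfst : Tendsto (fun q : ℝ × ℝ => q.1) (𝓝 p) (𝓝 p.1) := continuousAt_fst
  have hO : (fun q : ℝ × ℝ => q.1 - p.1) =O[𝓝 p] fun q => q - p :=
    .of_bound 1 (.of_forall fun q => by simpa using norm_fst_le (q - p))
  have hO2 : (fun q : ℝ × ℝ => q.2 - p.2) =O[𝓝 p] fun q => q - p :=
    .of_bound 1 (.of_forall fun q => by simpa using norm_snd_le (q - p))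
  have dF := ((h.hasDerivAt_reflect_lapse hA θ).isLittleO.comp_tendsto hfst).trans_isBigO hO
  have dP := ((h.hasDerivAt_dist hA θ).isLittleO.comp_tendsto hfst).trans_isBigO hO
  have oP : (fun q : ℝ × ℝ => dist b₁ q.1 θ - dist b₁ p.1 θ) =O[𝓝 p] fun q => q - p :=
    ((h.hasDerivAt_dist hA θ).isBigO_sub.comp_tendsto hfst).trans hO
  have eP : ∀ᶠ q in 𝓝 p, dist b₁ q.1 (angle b₁ q) = q.2 := by
    filter_upwards [h.isOpen_region.mem_nhds hp] with q hq using h.dist_angle hq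
  have o1 : (fun q : ℝ × ℝ => dist b₁ q.1 (angle b₁ q) - dist b₁ q.1 θ) =O[𝓝 p]
      fun q => q - p := by
    refine (hO2.sub oP).congr' ?_ .rfl
    filter_upwards [eP] with q hq
    rw [hq, hθ, h.dist_angle hp]; ring
  have hlim : Tendsto (fun q : ℝ × ℝ => (q.1, angle b₁ q)) (𝓝 p) (𝓝 (p.1, θ)) :=
    hfst.prodMk_nhds (h.continuousAt_angle hp)
  have d1 : (fun q : ℝ × ℝ => reflect (lapse b₂ q.1) (angle b₁ q) - reflect (lapse b₂ q.1) θ -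
      Q * (dist b₁ q.1 (angle b₁ q) - dist b₁ q.1 θ)) =o[𝓝 p] fun q => q - p := by
    refine Asymptotics.IsLittleO.trans_isBigO (Asymptotics.IsLittleO.of_bound fun ε hε => ?_) o1
    exact hlim.eventually (h.eventually_abs_reflect_lapse_sub_le hA hm hε)
  rw [hasFDerivAt_iff_isLittleO]
  -- The increment is split by first moving the angle at the new A (`d1`), then moving A at the old
  -- angle (`dF`). In the first part the distance increment is Δρ minus the A-increment of the
  -- distance, which `dP` linearizes.
  refine ((d1.add dF).sub (dP.const_mul_left Q)).congr' ?_ .rfl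
  filter_upwards [eP] with q hq
  have hp2 : dist b₁ p.1 θ = p.2 := h.dist_angle hp
  simp only [potential, ← hθ, hq, hp2, Function.comp, _root_.add_apply,
    _root_.smul_apply, ContinuousLinearMap.coe_fst', ContinuousLinearMap.coe_snd',
    smul_eq_mul, Prod.fst_sub, Prod.snd_sub]
  ring

theorem continuousAt_comp_angle {G : ℝ → ℝ → ℝ} (h : InverseProfile b₁ b₂ b₃ v K) {p : ℝ × ℝ}
    (hp : p ∈ region b₁)
    (hG : ContinuousAt (fun q : ℝ × ℝ => G q.1 q.2) (p.1, angle b₁ p)) :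
    ContinuousAt (fun q : ℝ × ℝ => G q.1 (angle b₁ q)) p :=
  hG.comp (f := fun q : ℝ × ℝ => (q.1, angle b₁ q))
    (continuousAt_fst.prodMk (h.continuousAt_angle hp))

theorem contDiffOn_potential (h : InverseProfile b₁ b₂ b₃ v K) :
    ContDiffOn ℝ 1 (potential b₁ b₂) (region b₁) := by
  have hopen : IsOpen {p : ℝ × ℝ | 0 < p.1} := isOpen_lt continuous_const continuous_fst
  rw [show (1 : WithTop ℕ∞) = 0 + 1 from rfl, contDiffOn_succ_iff_fderiv_of_isOpen h.isOpen_region]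
  refine ⟨fun p hp => (h.hasFDerivAt_potential hp).differentiableAt.differentiableWithinAt,
    by simp, contDiffOn_zero.2 ?_⟩
  refine ContinuousOn.congr ?_ fun p hp => (h.hasFDerivAt_potential hp).fderiv
  intro p hp
  have c1 := h.continuousAt_comp_angle (G := fun A => reflect (lapseDeriv b₂ b₃ A)) hp
     (h.continuousAt_reflect_lapseDeriv hp.1 (h.angle_mem hp))
  have c2 := h.continuousAt_comp_angle (G := slope b₁ b₂ v) hp
    (h.continuousOn_slope.continuousAt (hopen.mem_nhds hp.1))
  have c3 := h.continuousAt_comp_angle (G := distDeriv b₁ b₂) hp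
    (h.continuousOn_distDeriv.continuousAt (hopen.mem_nhds hp.1))
  exact (((c1.sub (c2.mul c3)).smul continuousAt_const).add
    (c2.smul continuousAt_const)).continuousWithinAt

theorem integral_one_div_one_add_cos :
    ∫ s in (0 : ℝ)..π / 2, 1 / (1 + cos s) = 1 := by
  have hc : ∀ s ∈ uIcc 0 (π / 2), 0 < 1 + cos s := fun s hs => by
    rw [uIcc_of_le (by positivity)] at hs
    have := cos_nonneg_of_neg_pi_div_two_le_of_le (by linarith [pi_pos, hs.1]) hs.2
    linarith
  rw [intervalIntegral.integral_eq_sub_of_hasDerivAt (f := fun s => sin s / (1 + cos s))]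
  · simp
  · intro s hs
    refine ((hasDerivAt_sin s).div ((hasDerivAt_cos s).const_add 1) (hc s hs).ne').congr_deriv ?_
    have := hc s hs
    field_simp
    linarith [sin_sq_add_cos_sq s]
  · exact (ContinuousOn.div (by fun_prop) (by fun_prop)
      fun s hs => (hc s hs).ne').intervalIntegrable

/-- From b₁ + u b₂ ≥ 0 and monotonicity of `flux`, -`bend`(A sin s) / A ≤ `flux`(A) / A = b₁(A). The
kernel is at most 1 / (1 + cos s), whose integral is exactly 1. -/
theorem lapse_le (h : InverseProfile b₁ b₂ b₃ v K) {A : ℝ} (hA : 0 < A) (θ : ℝ) :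
    lapse b₂ A θ ≤ b₁ A := by
  have hc : ∀ s ∈ Icc 0 (π / 2), 0 < 1 + cos s := fun s hs => by
    have := cos_nonneg_of_neg_pi_div_two_le_of_le (by linarith [pi_pos, hs.1]) hs.2
    linarith
  have hpi : (0 : ℝ) ≤ π / 2 := by positivity
  have e : b₁ A = ∫ s in (0 : ℝ)..π / 2, b₁ A * (1 / (1 + cos s)) := by
    rw [intervalIntegral.integral_const_mul, integral_one_div_one_add_cos, mul_one]
  rw [e, lapse, ← intervalIntegral.integral_neg]
  refine intervalIntegral.integral_mono_on_of_le_Ioo hpi ?_ ?_ fun s hs => ?_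
  · refine (intervalIntegrable_of_bounded (B := K * flux b₁ A / A)
      ((h.measurable_bend_mul_sin A).mul (measurable_kernel θ)) fun s hs => ?_).neg
    rw [uIoc_zero_pi_div_two] at hs
    exact abs_mul_kernel_le (m := fun s => bend b₂ (A * sin s) / A) (h.abs_bend_div_le hA s) hs
  · refine (ContinuousOn.mul continuousOn_const (ContinuousOn.div (by fun_prop) (by fun_prop)
      fun s hs => (hc s ?_).ne')).intervalIntegrable
    rwa [uIcc_of_le hpi] at hs
  · have hs' := sin_pos_of_mem ⟨hs.1, hs.2.le⟩
    have hu := mul_pos hA hs'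
    have h1 := h.lower _ hu
    have h2 := h.flux_mul_sin_le hA.le s
    rw [flux_of_pos hu, flux_of_pos hA] at h2
    have h3 : -(bend b₂ (A * sin s) / A) ≤ b₁ A := by
      rw [bend_of_pos hu, ← neg_div, div_le_iff₀ hA]
      nlinarith
    calc _ = -(bend b₂ (A * sin s) / A) * kernel θ s := by ring
      _ ≤ b₁ A * kernel θ s := mul_le_mul_of_nonneg_right h3 (kernel_nonneg θ s)
      _ ≤ _ := mul_le_mul_of_nonneg_left (kernel_le ⟨hs.1, hs.2.le⟩) (h.pos A hA).le

end InverseProfile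

/-! ### The inverse of the scale factor and the substitution a(t) = A sin s. -/

namespace RegularScaleFactor

open Real

variable {a : ℝ → ℝ}

/-- The inverse of the scale factor on `[0, ∞)`. -/
noncomputable def inverse (a : ℝ → ℝ) : ℝ → ℝ := Function.invFunOn a (Ici 0)

/-- The first derivative of the inverse of the scale factor. -/
noncomputable def inverseDeriv (a : ℝ → ℝ) (u : ℝ) : ℝ := 1 / deriv a (inverse a u)

/-- The second derivative of the inverse of the scale factor. -/
noncomputable def inverseDeriv₂ (a : ℝ → ℝ) (u : ℝ) : ℝ :=
  -deriv (deriv a) (inverse a u) / deriv a (inverse a u) ^ 3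

/-- The third derivative of the inverse of the scale factor. -/
noncomputable def inverseDeriv₃ (a : ℝ → ℝ) (u : ℝ) : ℝ :=
  3 * deriv (deriv a) (inverse a u) ^ 2 / deriv a (inverse a u) ^ 5 -
    deriv (deriv (deriv a)) (inverse a u) / deriv a (inverse a u) ^ 4

theorem pos (ha : RegularScaleFactor a) {t : ℝ} (ht : 0 < t) : 0 < a t := by
  have := ha.strictMonoOn self_mem_Ici ht.le ht
  rwa [ha.map_zero] at this

theorem inverse_nonneg (ha : RegularScaleFactor a) {u : ℝ} (hu : 0 ≤ u) : 0 ≤ inverse a u :=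
  Function.invFunOn_mem (ha.surjOn hu)

theorem map_inverse (ha : RegularScaleFactor a) {u : ℝ} (hu : 0 ≤ u) : a (inverse a u) = u :=
  Function.invFunOn_eq (ha.surjOn hu)

theorem inverse_map (ha : RegularScaleFactor a) {t : ℝ} (ht : 0 ≤ t) : inverse a (a t) = t := by
  have h0 : 0 ≤ a t := by
    rw [← ha.map_zero]; exact ha.strictMonoOn.monotoneOn self_mem_Ici ht ht
  exact ha.strictMonoOn.injOn (ha.inverse_nonneg h0) ht (ha.map_inverse h0)

theorem inverse_pos (ha : RegularScaleFactor a) {u : ℝ} (hu : 0 < u) : 0 < inverse a u := by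
  refine (ha.inverse_nonneg hu.le).lt_of_ne fun h => hu.ne ?_
  rw [← ha.map_inverse hu.le, ← h, ha.map_zero]

theorem inverse_strictMonoOn (ha : RegularScaleFactor a) : StrictMonoOn (inverse a) (Ici 0) := by
  intro x hx y hy hxy
  rw [← ha.strictMonoOn.lt_iff_lt (ha.inverse_nonneg hx) (ha.inverse_nonneg hy),
    ha.map_inverse hx, ha.map_inverse hy]
  exact hxy

theorem hasDerivAt (ha : RegularScaleFactor a) {t : ℝ} (ht : 0 < t) :
    HasDerivAt a (deriv a t) t :=
  ((ha.contDiffOn.contDiffAt (Ioi_mem_nhds ht)).differentiableAt (by norm_num)).hasDerivAt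

theorem contDiffOn_deriv (ha : RegularScaleFactor a) : ContDiffOn ℝ 1 (deriv a) (Ioi 0) :=
  ((contDiffOn_succ_iff_deriv_of_isOpen isOpen_Ioi (n := 1)).1
    (by simpa [one_add_one_eq_two] using ha.contDiffOn)).2.2

theorem hasDerivAt_deriv (ha : RegularScaleFactor a) {t : ℝ} (ht : 0 < t) :
    HasDerivAt (deriv a) (deriv (deriv a) t) t :=
  ((ha.contDiffOn_deriv.contDiffAt (Ioi_mem_nhds ht)).differentiableAt (by norm_num)).hasDerivAt

theorem hasDerivAt_inverse (ha : RegularScaleFactor a) {u : ℝ} (hu : 0 < u) :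
    HasDerivAt (inverse a) (inverseDeriv a u) u := by
  have ht := ha.inverse_pos hu
  have himg : inverse a '' Ioi 0 = Ioi 0 := by
    ext t
    refine ⟨?_, fun ht => ⟨a t, ha.pos ht, ha.inverse_map (le_of_lt ht)⟩⟩
    rintro ⟨w, hw, rfl⟩
    exact ha.inverse_pos hw
  have hc : ContinuousAt (inverse a) u :=
    (ha.inverse_strictMonoOn.mono Ioi_subset_Ici_self).continuousAt_of_image_mem_nhds
      (Ioi_mem_nhds hu) (by rw [himg]; exact Ioi_mem_nhds ht)
  rw [inverseDeriv, one_div]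
  refine HasDerivAt.of_local_left_inverse hc (ha.hasDerivAt ht) (ha.deriv_pos _ ht).ne' ?_
  filter_upwards [lt_mem_nhds hu] with w hw using ha.map_inverse hw.le

theorem tendsto_inverse (ha : RegularScaleFactor a) :
    Tendsto (inverse a) (𝓝[>] 0) (𝓝[>] 0) := by
  refine tendsto_nhdsWithin_iff.2 ⟨tendsto_order.2 ⟨fun c hc => ?_, fun c hc => ?_⟩, ?_⟩
  · filter_upwards [self_mem_nhdsWithin] with u hu using hc.trans (ha.inverse_pos hu)
  · filter_upwards [Ioo_mem_nhdsGT (ha.pos hc)] with u hu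
    have := ha.inverse_strictMonoOn hu.1.le (ha.pos hc).le hu.2
    rwa [ha.inverse_map hc.le] at this
  · filter_upwards [self_mem_nhdsWithin] with u hu using ha.inverse_pos hu

theorem tendsto_zero (ha : RegularScaleFactor a) : Tendsto a (𝓝[>] 0) (𝓝 0) := by
  have := (ha.continuousOn 0 self_mem_Ici).tendsto.mono_left (nhdsWithin_mono 0 Ioi_subset_Ici_self)
  rwa [ha.map_zero] at this

/-- If a' is nondecreasing near 0, the mean value theorem gives a(t) ≤ t a'(t). If a' has a positive
limit, the quotient tends to 0 because a does. -/
theorem tendsto_div_deriv (ha : RegularScaleFactor a) {v : ℝ}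
    (hv : Tendsto (deriv a) (𝓝[>] 0) (𝓝 v))
    (hcase : (v = 0 ∧ ∃ ε : ℝ, 0 < ε ∧ ∀ t ∈ Ioo 0 ε, 0 ≤ deriv (deriv a) t) ∨ 0 < v) :
    Tendsto (fun t => a t / deriv a t) (𝓝[>] 0) (𝓝 0) := by
  rcases hcase with ⟨-, ε, hε, hconv⟩ | hv0
  · have hmono : MonotoneOn (deriv a) (Ioo 0 ε) := by
      refine monotoneOn_of_deriv_nonneg (convex_Ioo 0 ε) ?_ ?_ ?_
      · exact fun t ht => (ha.hasDerivAt_deriv ht.1).continuousAt.continuousWithinAt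
      · rw [interior_Ioo]
        exact fun t ht => (ha.hasDerivAt_deriv ht.1).differentiableAt.differentiableWithinAt
      · rwa [interior_Ioo]
    have hid : Tendsto (fun t : ℝ => t) (𝓝[>] 0) (𝓝 0) := tendsto_id.mono_left nhdsWithin_le_nhds
    refine squeeze_zero' ?_ ?_ hid
    · filter_upwards [self_mem_nhdsWithin] with t ht
      exact div_nonneg (ha.pos ht).le (ha.deriv_pos t ht).le
    · filter_upwards [Ioo_mem_nhdsGT hε] with t ht
      obtain ⟨c, hc, he⟩ := exists_hasDerivAt_eq_slope a (deriv a) ht.1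
        (ha.continuousOn.mono Icc_subset_Ici_self) fun x hx => ha.hasDerivAt hx.1
      have hle : deriv a c ≤ deriv a t := hmono ⟨hc.1, hc.2.trans ht.2⟩ ht hc.2.le
      rw [ha.map_zero, sub_zero, sub_zero, eq_div_iff ht.1.ne'] at he
      rw [div_le_iff₀ (ha.deriv_pos t ht.1), ← he, mul_comm]
      exact mul_le_mul_of_nonneg_left hle ht.1.le
  · have := ha.tendsto_zero.div hv hv0.ne'
    rwa [zero_div] at this

/-- With u = a(t) one has u b''/b' = -a a''/a'² and u² b'''/b' = 3 (a a''/a'²)² - a''' a²/a'³, so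
the bounds are those assumed on a. -/
theorem inverseProfile (ha : StronglyRegularScaleFactor a) {v : ℝ}
    (hv : Tendsto (deriv a) (𝓝[>] 0) (𝓝 v))
    (hcase : (v = 0 ∧ ∃ ε : ℝ, 0 < ε ∧ ∀ t ∈ Ioo 0 ε, 0 ≤ deriv (deriv a) t) ∨ 0 < v)
    (ha₃ : ∀ t, 0 < t → DifferentiableAt ℝ (deriv (deriv a)) t) {C : ℝ}
    (hC : ∀ t, 0 < t → |deriv (deriv (deriv a)) t * a t ^ 2 / deriv a t ^ 3| ≤ C) :
    ∃ K, InverseProfile (inverseDeriv a) (inverseDeriv₂ a) (inverseDeriv₃ a) v K := by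
  obtain ⟨K, hK, hlow⟩ := ha.ratio_ge
  have hr := ha.toRegularScaleFactor
  have hC0 : 0 ≤ C := (abs_nonneg _).trans (hC 1 one_pos)
  have habs : ∀ t, 0 < t → |a t * deriv (deriv a) t / deriv a t ^ 2| ≤ K := fun t ht =>
    abs_le.2 ⟨hlow t ht, (ha.ratio_le_one t ht).trans hK⟩
  -- The second derivative needs K and the third needs 3K² + C; the sum serves both.
  refine ⟨K + 3 * K ^ 2 + C, ⟨fun u hu => ?_, fun u hu => ?_, fun u hu => ?_, fun u hu => ?_,
    fun u hu => ?_, fun u hu => ?_, ?_, ?_⟩⟩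
  · exact one_div_pos.2 (ha.deriv_pos _ (hr.inverse_pos hu))
  · have ht := hr.inverse_pos hu
    have hd := ha.deriv_pos _ ht
    have := ((hr.hasDerivAt_deriv ht).comp u (hr.hasDerivAt_inverse hu)).fun_inv hd.ne'
    unfold inverseDeriv inverseDeriv₂
    simp only [one_div]
    refine this.congr_deriv ?_
    simp only [inverseDeriv, Function.comp]
    field_simp
  · have ht := hr.inverse_pos hu
    have hd := ha.deriv_pos _ ht
    have h1 := (hr.hasDerivAt_deriv ht).comp u (hr.hasDerivAt_inverse hu)
    have h2 := (ha₃ _ ht).hasDerivAt.comp u (hr.hasDerivAt_inverse hu)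
    refine (h2.neg.div (h1.pow 3) (pow_ne_zero 3 hd.ne')).congr_deriv ?_
    simp only [inverseDeriv, inverseDeriv₃, Function.comp, Pi.neg_apply, Pi.pow_apply]
    field_simp
    ring
  -- The two limit goals have no `hu` in scope, so `try` leaves them unchanged.
  all_goals try
    have ht := hr.inverse_pos hu
    have hd := ha.deriv_pos _ ht
    have hau := hr.map_inverse hu.le
    have h1 := ha.ratio_le_one _ ht
    have h2 := habs _ ht
    have h3 := hC _ ht
    rw [hau] at h1 h2 h3
    simp only [inverseDeriv, inverseDeriv₂, inverseDeriv₃]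
    set t := inverse a u
  · have : 1 / deriv a t + u * (-deriv (deriv a) t / deriv a t ^ 3) =
        (1 - u * deriv (deriv a) t / deriv a t ^ 2) / deriv a t := by field_simp; ring
    rw [this]
    exact div_nonneg (by linarith) hd.le
  · have : u * (-deriv (deriv a) t / deriv a t ^ 3) =
        -(u * deriv (deriv a) t / deriv a t ^ 2) * (1 / deriv a t) := by field_simp
    rw [this, abs_mul, abs_neg, abs_of_pos (one_div_pos.2 hd)]
    have : 0 ≤ 3 * K ^ 2 := by positivity
    exact mul_le_mul_of_nonneg_right (by linarith) (one_div_pos.2 hd).le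
  · have : u ^ 2 * (3 * deriv (deriv a) t ^ 2 / deriv a t ^ 5 -
        deriv (deriv (deriv a)) t / deriv a t ^ 4) =
        (3 * (u * deriv (deriv a) t / deriv a t ^ 2) ^ 2 -
          deriv (deriv (deriv a)) t * u ^ 2 / deriv a t ^ 3) * (1 / deriv a t) := by field_simp
    rw [this, abs_mul, abs_of_pos (one_div_pos.2 hd)]
    refine mul_le_mul_of_nonneg_right ((abs_sub _ _).trans ?_) (one_div_pos.2 hd).le
    have h4 : |3 * (u * deriv (deriv a) t / deriv a t ^ 2) ^ 2| ≤ 3 * K ^ 2 := by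
      rw [abs_mul, abs_pow, abs_of_pos (by norm_num : (0 : ℝ) < 3)]
      gcongr
    linarith
  · refine ((hr.tendsto_div_deriv hv hcase).comp hr.tendsto_inverse).congr' ?_
    filter_upwards [self_mem_nhdsWithin] with u hu
    simp only [Function.comp, inverseDeriv]
    rw [hr.map_inverse (le_of_lt hu), mul_one_div]
  · simpa [inverseDeriv, Function.comp_def] using hv.comp hr.tendsto_inverse

theorem sqrt_sq_sub_sq {A s : ℝ} (hA : 0 ≤ A) (hs : 0 ≤ cos s) :
    √(A ^ 2 - (A * sin s) ^ 2) = A * cos s := by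
  rw [← sqrt_sq (mul_nonneg hA hs)]
  congr 1
  rw [mul_pow A (cos s), cos_sq']
  ring

/-- The substitution `a t = A sin s`. -/
theorem integral_substitution (ha : RegularScaleFactor a) {A θ₁ θ₂ x₁ x₂ : ℝ} (hA : 0 < A)
    (h0 : 0 ≤ θ₁) (h12 : θ₁ ≤ θ₂) (h2 : θ₂ ≤ π / 2) (hx₁ : 0 ≤ x₁) (hx₂ : 0 ≤ x₂)
    (e₁ : a x₁ = A * sin θ₁) (e₂ : a x₂ = A * sin θ₂) {h H : ℝ → ℝ}
    (hH : ∀ s ∈ Ioo θ₁ θ₂, 0 < cos s → 0 < sin s → 0 < inverse a (A * sin s) →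
      a (inverse a (A * sin s)) = A * sin s →
      h (inverse a (A * sin s)) * (A * cos s / deriv a (inverse a (A * sin s))) = H s) :
    ∫ t in x₁..x₂, h t = ∫ s in θ₁..θ₂, H s ∧
      (IntervalIntegrable H volume θ₁ θ₂ → IntervalIntegrable h volume x₁ x₂) := by
  have hpi := pi_pos
  have hcos : ∀ s ∈ Ioo θ₁ θ₂, 0 < cos s := fun s hs =>
    cos_pos_of_mem_Ioo ⟨by linarith [hs.1], by linarith [hs.2]⟩
  have hsin : ∀ s ∈ Ioo θ₁ θ₂, 0 < sin s := fun s hs =>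
    sin_pos_of_pos_of_lt_pi (by linarith [hs.1]) (by linarith [hs.2])
  have hx : x₁ ≤ x₂ := by
    rw [← ha.strictMonoOn.le_iff_le hx₁ hx₂, e₁, e₂]
    exact mul_le_mul_of_nonneg_left
      (sin_le_sin_of_le_of_le_pi_div_two (by linarith) h2 h12) hA.le
  set g : ℝ → ℝ := fun s => inverse a (A * sin s) with hg
  set g' : ℝ → ℝ := fun s => A * cos s / deriv a (inverse a (A * sin s)) with hg'
  have hd : ∀ s ∈ Ioo θ₁ θ₂, HasDerivWithinAt g (g' s) (Ioo θ₁ θ₂) s := fun s hs => by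
    refine (((ha.hasDerivAt_inverse (mul_pos hA (hsin s hs))).comp s
      ((hasDerivAt_sin s).const_mul A)).congr_deriv ?_).hasDerivWithinAt
    rw [inverseDeriv, hg']; ring
  have hmono : StrictMonoOn g (Icc θ₁ θ₂) := by
    intro s hs r hr hsr
    have hsin0 : ∀ z ∈ Icc θ₁ θ₂, 0 ≤ A * sin z := fun z hz =>
      mul_nonneg hA.le (sin_nonneg_of_nonneg_of_le_pi (by linarith [hz.1]) (by linarith [hz.2]))
    exact ha.inverse_strictMonoOn (hsin0 s hs) (hsin0 r hr) (mul_lt_mul_of_pos_left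
      (sin_lt_sin_of_lt_of_le_pi_div_two (by linarith [hs.1]) (hr.2.trans h2) hsr) hA)
  have g1 : g θ₁ = x₁ := by rw [hg]; simp only; rw [← e₁, ha.inverse_map hx₁]
  have g2 : g θ₂ = x₂ := by rw [hg]; simp only; rw [← e₂, ha.inverse_map hx₂]
  have himg : g '' Ioo θ₁ θ₂ = Ioo x₁ x₂ := by
    ext t
    constructor
    · rintro ⟨s, hs, rfl⟩
      rw [← g1, ← g2]
      exact ⟨hmono (left_mem_Icc.2 h12) (Ioo_subset_Icc_self hs) hs.1,
        hmono (Ioo_subset_Icc_self hs) (right_mem_Icc.2 h12) hs.2⟩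
    · intro ht
      have ht0 : 0 ≤ t := hx₁.trans ht.1.le
      have l1 := ha.strictMonoOn hx₁ ht0 ht.1
      have l2 := ha.strictMonoOn ht0 hx₂ ht.2
      rw [e₁] at l1
      rw [e₂] at l2
      obtain ⟨s, hs, he⟩ := intermediate_value_Ioo h12
        (by fun_prop : Continuous fun s => A * sin s).continuousOn ⟨l1, l2⟩
      exact ⟨s, hs, by simp only [hg, he]; exact ha.inverse_map ht0⟩
  have hinj : InjOn g (Ioo θ₁ θ₂) := hmono.injOn.mono Ioo_subset_Icc_self
  have hcongr : ∀ s ∈ Ioo θ₁ θ₂, |g' s| • h (g s) = H s := fun s hs => by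
    have hp := ha.inverse_pos (mul_pos hA (hsin s hs))
    have hg0 : 0 < g' s := div_pos (mul_pos hA (hcos s hs)) (ha.deriv_pos _ hp)
    rw [abs_of_pos hg0, smul_eq_mul, mul_comm]
    exact hH s hs (hcos s hs) (hsin s hs) hp (ha.map_inverse (mul_pos hA (hsin s hs)).le)
  constructor
  -- Open intervals discard the endpoints, where the inverse may fail to be differentiable or cos s
  -- may vanish. The change of variables for injective maps requires no integrability.
  · rw [intervalIntegral.integral_of_le hx, intervalIntegral.integral_of_le h12,
      integral_Ioc_eq_integral_Ioo, integral_Ioc_eq_integral_Ioo, ← himg,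
      integral_image_eq_integral_abs_deriv_smul measurableSet_Ioo hd hinj]
    exact setIntegral_congr_fun measurableSet_Ioo hcongr
  · intro hi
    rw [intervalIntegrable_iff_integrableOn_Ioo_of_le h12] at hi
    rw [intervalIntegrable_iff_integrableOn_Ioo_of_le hx, ← himg,
      integrableOn_image_iff_integrableOn_abs_deriv_smul measurableSet_Ioo hd hinj]
    exact hi.congr_fun (fun s hs => (hcongr s hs).symm) measurableSet_Ioo

end RegularScaleFactor

/-! ### Integration by parts for the integral with exponent 3/2. -/

namespace InverseProfile

open Real

variable {b₁ b₂ b₃ : ℝ → ℝ} {v K : ℝ}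

theorem distDeriv_sub (h : InverseProfile b₁ b₂ b₃ v K) (A θ : ℝ) :
    distDeriv b₁ b₂ A 0 - distDeriv b₁ b₂ A θ =
      ∫ s in (0 : ℝ)..θ, (flux b₁ (A * sin s) + bend b₂ (A * sin s)) / A := by
  have c := h.continuous_flux
  have c2 := h.continuous_bend
  have hi : ∀ x y, IntervalIntegrable
      (fun s => (flux b₁ (A * sin s) + bend b₂ (A * sin s)) / A) volume x y := fun x y =>
    (by fun_prop : Continuous fun s =>
      (flux b₁ (A * sin s) + bend b₂ (A * sin s)) / A).intervalIntegrable x y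
  rw [distDeriv, distDeriv, ← intervalIntegral.integral_add_adjacent_intervals (hi 0 θ) (hi θ _),
    add_sub_cancel_right]

theorem distDeriv_neg (h : InverseProfile b₁ b₂ b₃ v K) (A θ : ℝ) :
    distDeriv b₁ b₂ A (-θ) = 2 * distDeriv b₁ b₂ A 0 - distDeriv b₁ b₂ A θ := by
  have h1 := h.distDeriv_sub A θ
  have h2 := h.distDeriv_sub A (-θ)
  rw [integral_neg_eq_of_even fun s => by rw [sin_neg, mul_neg, flux_neg, bend_neg]] at h2
  linarith

theorem integral_flux_div_cos_sq (h : InverseProfile b₁ b₂ b₃ v K) {A θ : ℝ} (hA : 0 < A)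
    (h0 : 0 ≤ θ) (h1 : θ < π / 2) :
    ∫ s in (0 : ℝ)..θ, flux b₁ (A * sin s) / cos s ^ 2 =
      flux b₁ (A * sin θ) * (sin θ / cos θ) -
        A * (distDeriv b₁ b₂ A 0 - distDeriv b₁ b₂ A θ) := by
  have c := h.continuous_flux
  have c2 := h.continuous_bend
  have hcos : ∀ s ∈ uIcc 0 θ, cos s ≠ 0 := fun s hs => by
    rw [uIcc_of_le h0] at hs
    exact (cos_pos_of_mem_Ioo ⟨by linarith [pi_pos, hs.1], by linarith [hs.2]⟩).ne'
  have i1 : IntervalIntegrable (fun s => flux b₁ (A * sin s) / cos s ^ 2) volume 0 θ :=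
    (ContinuousOn.div (by fun_prop) (by fun_prop)
      fun s hs => pow_ne_zero 2 (hcos s hs)).intervalIntegrable
  have i2 : IntervalIntegrable (fun s => flux b₁ (A * sin s) + bend b₂ (A * sin s)) volume 0 θ :=
    (by fun_prop : Continuous fun s =>
      flux b₁ (A * sin s) + bend b₂ (A * sin s)).intervalIntegrable _ _
  have key := intervalIntegral.integral_eq_sub_of_hasDerivAt_of_le h0
    -- The derivative of `flux` at A sin s is (`flux` + `bend`) cot s, so multiplying by tan s
    -- leaves precisely the integrand of A · `distDeriv`.
    (f := fun s => flux b₁ (A * sin s) * (sin s / cos s))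
    (f' := fun s => flux b₁ (A * sin s) / cos s ^ 2 +
      (flux b₁ (A * sin s) + bend b₂ (A * sin s))) ?_ (fun s hs => ?_) (i1.add i2)
  · rw [intervalIntegral.integral_add i1 i2] at key
    rw [h.distDeriv_sub, intervalIntegral.integral_div, mul_div_cancel₀ _ hA.ne']
    simp only [sin_zero, zero_div, mul_zero, sub_zero] at key
    linarith
  · rw [← uIcc_of_le h0]
    exact (by fun_prop : Continuous fun s => flux b₁ (A * sin s)).continuousOn.mul
      (ContinuousOn.div (by fun_prop) (by fun_prop) hcos)
  · have hc : cos s ≠ 0 := hcos s (by rw [uIcc_of_le h0]; exact Ioo_subset_Icc_self hs)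
    have hsin := sin_pos_of_mem ⟨hs.1, by linarith [hs.2]⟩
    refine (((h.hasDerivAt_flux (mul_pos hA hsin)).comp s
      ((hasDerivAt_sin s).const_mul A)).mul
        ((hasDerivAt_sin s).div (hasDerivAt_cos s) hc)).congr_deriv ?_
    simp only [Function.comp, Pi.div_apply]
    field_simp
    linear_combination (flux b₁ (A * sin s)) * sin_sq_add_cos_sq s

end InverseProfile

/-! ### The integrals of the statement in angular coordinates. -/

namespace RegularScaleFactor

open Real InverseProfile FermiChart

variable {a : ℝ → ℝ} {v K : ℝ}

theorem map_eq_mul_sin (τ : ℝ) : a τ = a τ * sin (π / 2) := by simp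

theorem integrand_properDist (ha : RegularScaleFactor a) {τ s : ℝ} (hτ : 0 < τ) (hc : 0 < cos s)
    (hs : 0 < sin s) (hat : a (inverse a (a τ * sin s)) = a τ * sin s) :
    a (inverse a (a τ * sin s)) / √(a τ ^ 2 - a (inverse a (a τ * sin s)) ^ 2) *
      (a τ * cos s / deriv a (inverse a (a τ * sin s))) =
      flux (inverseDeriv a) (a τ * sin s) := by
  have hA := ha.pos hτ
  rw [hat, sqrt_sq_sub_sq hA.le hc.le, flux_of_pos (mul_pos hA hs), inverseDeriv]
  field_simp

theorem radius_eq (ha : RegularScaleFactor a) {τ : ℝ} (hτ : 0 < τ) :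
    radius a τ = dist (inverseDeriv a) (a τ) 0 :=
  (ha.integral_substitution (ha.pos hτ) le_rfl (by positivity) le_rfl le_rfl hτ.le
    (by simp [ha.map_zero]) (map_eq_mul_sin τ)
    (h := fun t => a t / √(a τ ^ 2 - a t ^ 2))
    (H := fun s => flux (inverseDeriv a) (a τ * sin s))
    fun s _ hc hs _ hat => ha.integrand_properDist hτ hc hs hat).1

theorem properDist_of_nonneg (ha : RegularScaleFactor a) {τ x θ : ℝ} (hτ : 0 < τ) (h0 : 0 ≤ θ)
    (h1 : θ ≤ π / 2) (hx : 0 ≤ x) (e : a x = a τ * sin θ) :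
    properDist a τ x = dist (inverseDeriv a) (a τ) θ := by
  refine (ha.integral_substitution (ha.pos hτ) h0 h1 le_rfl hx hτ.le e (map_eq_mul_sin τ)
    (H := fun s => flux (inverseDeriv a) (a τ * sin s)) fun s _ hc hs hp hat => ?_).1
  simp only [abs_of_pos hp]
  exact ha.integrand_properDist hτ hc hs hat

theorem properDist_neg (ha : RegularScaleFactor a)
    (h : InverseProfile (inverseDeriv a) (inverseDeriv₂ a) (inverseDeriv₃ a) v K)
    {τ x θ : ℝ} (hτ : 0 < τ) (h0 : 0 ≤ θ)
    (h1 : θ ≤ π / 2) (hx : 0 ≤ x) (e : a x = a τ * sin θ) :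
    properDist a τ (-x) = dist (inverseDeriv a) (a τ) (-θ) := by
  have c := h.continuous_flux
  have hA := ha.pos hτ
  have hi : ∀ θ₁ θ₂, IntervalIntegrable (fun s => flux (inverseDeriv a) (a τ * sin s))
      volume θ₁ θ₂ := fun θ₁ θ₂ =>
    (by fun_prop : Continuous fun s => flux (inverseDeriv a) (a τ * sin s)).intervalIntegrable _ _
  have s1 := ha.integral_substitution hA le_rfl h0 h1 le_rfl hx
    (by simp [ha.map_zero]) e (h := fun t => a |t| / √(a τ ^ 2 - a |t| ^ 2))
    (H := fun s => flux (inverseDeriv a) (a τ * sin s)) fun s _ hc hs hp hat => by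
      simp only [abs_of_pos hp]
      exact ha.integrand_properDist hτ hc hs hat
  have s2 := ha.integral_substitution hA le_rfl (by positivity) le_rfl le_rfl hτ.le
    (by simp [ha.map_zero]) (map_eq_mul_sin τ) (h := fun t => a |t| / √(a τ ^ 2 - a |t| ^ 2))
    (H := fun s => flux (inverseDeriv a) (a τ * sin s)) fun s _ hc hs hp hat => by
      simp only [abs_of_pos hp]
      exact ha.integrand_properDist hτ hc hs hat
  have i1 : IntervalIntegrable (fun t => a |t| / √(a τ ^ 2 - a |t| ^ 2)) volume (-x) 0 := by
    have := ((s1.2 (hi _ _)).comp_sub_left 0).symm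
    simpa using this
  have e1 := h.dist_sub_dist (a τ) 0 θ
  rw [← s1.1] at e1
  have e2 : ∫ t in (0 : ℝ)..-x, a |t| / √(a τ ^ 2 - a |t| ^ 2) =
      -∫ t in (0 : ℝ)..x, a |t| / √(a τ ^ 2 - a |t| ^ 2) :=
    integral_neg_eq_of_even (fun s => by rw [abs_neg]) x
  rw [properDist, ← intervalIntegral.integral_add_adjacent_intervals i1 (s2.2 (hi _ _)), s2.1,
    intervalIntegral.integral_symm, e2, h.dist_neg, ← e1]
  change _ + dist (inverseDeriv a) (a τ) 0 = _
  ring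

theorem fNonneg_eq (ha : RegularScaleFactor a)
    (h : InverseProfile (inverseDeriv a) (inverseDeriv₂ a) (inverseDeriv₃ a) v K)
    {τ x θ : ℝ} (hτ : 0 < τ) (h0 : 0 ≤ θ)
    (h1 : θ ≤ π / 2) (hx : 0 ≤ x) (e : a x = a τ * sin θ) :
    fNonneg a τ x = lapse (inverseDeriv₂ a) (a τ) θ := by
  have hA := ha.pos hτ
  have hcθ := cos_nonneg_of_neg_pi_div_two_le_of_le (by linarith [pi_pos]) h1
  rw [h.lapse_eq hA h0 h1, ← intervalIntegral.integral_neg]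
  refine (ha.integral_substitution hA h0 h1 le_rfl hx hτ.le e (map_eq_mul_sin τ)
    fun s _ hc hs hp hat => ?_).1
  have hd := ha.deriv_pos _ hp
  rw [hat, e, sqrt_sq_sub_sq hA.le hc.le, sqrt_sq_sub_sq hA.le hcθ, inverseDeriv₂]
  field_simp

theorem J_eq (ha : RegularScaleFactor a) {τ x θ : ℝ} (hτ : 0 < τ) (h0 : 0 ≤ θ)
    (h1 : θ ≤ π / 2) (hx : 0 ≤ x) (e : a x = a τ * sin θ) :
    J a τ x = -∫ s in θ..π / 2, inverseDeriv₂ a (a τ * sin s) := by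
  have hA := ha.pos hτ
  rw [← intervalIntegral.integral_neg]
  refine (ha.integral_substitution hA h0 h1 le_rfl hx hτ.le e (map_eq_mul_sin τ)
    fun s _ hc hs hp hat => ?_).1
  have hd := ha.deriv_pos _ hp
  rw [hat, sqrt_sq_sub_sq hA.le hc.le, inverseDeriv₂]
  field_simp

theorem deriv_mul_J (ha : RegularScaleFactor a)
    (h : InverseProfile (inverseDeriv a) (inverseDeriv₂ a) (inverseDeriv₃ a) v K)
    {τ x θ : ℝ} (hτ : 0 < τ) (h0 : 0 < θ)
    (h1 : θ ≤ π / 2) (hx : 0 ≤ x) (e : a x = a τ * sin θ) :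
    deriv a x * J a τ x = slope (inverseDeriv a) (inverseDeriv₂ a) v (a τ) θ := by
  rw [ha.J_eq hτ h0.le h1 hx e, h.slope_eq (ha.pos hτ) h0 h1, inverseDeriv, ← e,
    ha.inverse_map hx]
  simp

theorem radiusDeriv_eq (ha : RegularScaleFactor a) {τ : ℝ} (hτ : 0 < τ) :
    radiusDeriv a τ = deriv a τ * distDeriv (inverseDeriv a) (inverseDeriv₂ a) (a τ) 0 := by
  have hA := ha.pos hτ
  rw [radiusDeriv, distDeriv, intervalIntegral.integral_div]
  rw [(ha.integral_substitution hA le_rfl (by positivity) le_rfl le_rfl hτ.le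
    (by simp [ha.map_zero]) (map_eq_mul_sin τ)
    (h := fun t => (1 - a t * deriv (deriv a) t / deriv a t ^ 2) * (a t / √(a τ ^ 2 - a t ^ 2)))
    (H := fun s => flux (inverseDeriv a) (a τ * sin s) + bend (inverseDeriv₂ a) (a τ * sin s))
    fun s _ hc hs hp hat => ?_).1]
  · ring
  have hd := ha.deriv_pos _ hp
  have hu := mul_pos hA hs
  rw [hat, sqrt_sq_sub_sq hA.le hc.le, flux_of_pos hu, bend_of_pos hu, inverseDeriv, inverseDeriv₂]
  field_simp
  ring

theorem rpow_three_halves {y : ℝ} (hy : 0 ≤ y) : (y ^ 2) ^ (3 / 2 : ℝ) = y ^ 3 := by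
  rw [← rpow_natCast_mul hy, ← rpow_natCast]
  norm_num

theorem dτG_eq (ha : RegularScaleFactor a)
    (h : InverseProfile (inverseDeriv a) (inverseDeriv₂ a) (inverseDeriv₃ a) v K)
    {τ x θ : ℝ} (hτ : 0 < τ) (h0 : 0 ≤ θ)
    (h1 : θ < π / 2) (hx : 0 ≤ x) (e : a x = a τ * sin θ) :
    dτG a τ x = -deriv a τ *
      (flux (inverseDeriv a) (a τ * sin θ) * (sin θ / cos θ) / a τ -
        (distDeriv (inverseDeriv a) (inverseDeriv₂ a) (a τ) 0 -
          distDeriv (inverseDeriv a) (inverseDeriv₂ a) (a τ) θ)) := by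
  have hA := ha.pos hτ
  have key := h.integral_flux_div_cos_sq hA h0 h1
  rw [dτG, (ha.integral_substitution hA le_rfl h0 h1.le le_rfl hx
    (by simp [ha.map_zero]) e (h := fun t => a |t| / (a τ ^ 2 - a |t| ^ 2) ^ (3 / 2 : ℝ))
    (H := fun s => 1 / a τ ^ 2 * (flux (inverseDeriv a) (a τ * sin s) / cos s ^ 2))
    fun s _ hc hs hp hat => ?_).1, intervalIntegral.integral_const_mul, key]
  · field_simp
  have hd := ha.deriv_pos _ hp
  have hu := mul_pos hA hs
  have hsq : a τ ^ 2 - (a τ * sin s) ^ 2 = (a τ * cos s) ^ 2 := by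
    rw [mul_pow, mul_pow, cos_sq']; ring
  rw [abs_of_pos hp, hat, flux_of_pos hu, hsq, rpow_three_halves (mul_pos hA hc).le, inverseDeriv]
  field_simp

theorem dτG_neg (a : ℝ → ℝ) (τ x : ℝ) : dτG a τ (-x) = -dτG a τ x := by
  rw [dτG, integral_neg_eq_of_even (fun s => by rw [abs_neg]), dτG]
  ring

/-- The left side differentiates f at fixed t₀, while `lapseDeriv` does so at fixed θ. Since a(t₀) =
A sin θ, fixing t₀ gives dθ/dA = -tan θ / A, which accounts for the second term. -/
theorem I₁_add_I₂ (ha : RegularScaleFactor a)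
    (h : InverseProfile (inverseDeriv a) (inverseDeriv₂ a) (inverseDeriv₃ a) v K)
    {τ x θ : ℝ} (hτ : 0 < τ) (h0 : 0 < θ)
    (h1 : θ < π / 2) (hx : 0 ≤ x) (e : a x = a τ * sin θ) :
    I₁ a τ x + I₂ a τ x = deriv a τ * (lapseDeriv (inverseDeriv₂ a) (inverseDeriv₃ a) (a τ) θ +
      flux (inverseDeriv a) (a τ * sin θ) * slope (inverseDeriv a) (inverseDeriv₂ a) v (a τ) θ *
        (sin θ / cos θ) / a τ) := by
  have hA := ha.pos hτ
  have hcθ : 0 < cos θ := cos_pos_of_mem_Ioo ⟨by linarith [pi_pos], h1⟩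
  have hsθ := sin_pos_of_mem ⟨h0, h1.le⟩
  have hX := mul_pos hA hsθ
  have hi1 := h.intervalIntegrable_lapseDeriv hA h0 h1.le
  have hi2 : ∀ g : ℝ → ℝ, Continuous g → IntervalIntegrable
      (fun s => inverseDeriv₂ a (a τ * sin s) * g s) volume θ (π / 2) := fun g hg =>
    h.intervalIntegrable_two_mul hA h0 h1.le hg.continuousOn
  rw [I₁, I₂, (ha.integral_substitution hA h0.le h1.le le_rfl hx hτ.le e (map_eq_mul_sin τ)
    (H := fun s => a τ * ((inverseDeriv₂ a (a τ * sin s) +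
      a τ * sin s * inverseDeriv₃ a (a τ * sin s)) * (cos θ - cos s) -
      inverseDeriv₂ a (a τ * sin s) * (cos θ - cos s)))
    fun s _ hc hs hp hat => ?_).1, (ha.integral_substitution hA h0.le h1.le le_rfl hx hτ.le e
      (map_eq_mul_sin τ)
    (H := fun s => a τ * -(inverseDeriv₂ a (a τ * sin s) * (1 / cos θ - cos s)))
    fun s _ hc hs hp hat => ?_).1, h.lapseDeriv_eq hA h0.le h1.le, h.slope_eq hA h0 h1.le,
    intervalIntegral.integral_const_mul, intervalIntegral.integral_const_mul,
    intervalIntegral.integral_sub hi1 (hi2 _ (by fun_prop)), intervalIntegral.integral_neg]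
  · have e1 : ∫ s in θ..π / 2, inverseDeriv₂ a (a τ * sin s) * (1 / cos θ - cos s) =
        (∫ s in θ..π / 2, inverseDeriv₂ a (a τ * sin s) * (cos θ - cos s)) +
          (∫ s in θ..π / 2, inverseDeriv₂ a (a τ * sin s)) * (1 / cos θ - cos θ) := by
      rw [← intervalIntegral.integral_mul_const, ← intervalIntegral.integral_add
        (hi2 _ (by fun_prop)) (hi2 _ (by fun_prop))]
      congr 1
      ext s
      ring
    have hb := h.pos _ hX
    rw [e1, flux_of_pos hX]
    generalize (∫ s in θ..π / 2, inverseDeriv₂ a (a τ * sin s)) = L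
    generalize (∫ s in θ..π / 2, inverseDeriv₂ a (a τ * sin s) * (cos θ - cos s)) = M
    generalize (∫ s in θ..π / 2, (inverseDeriv₂ a (a τ * sin s) +
      a τ * sin s * inverseDeriv₃ a (a τ * sin s)) * (cos θ - cos s)) = N
    field_simp
    linear_combination (deriv a τ * L) * sin_sq_add_cos_sq θ
  · have hd := ha.deriv_pos _ hp
    rw [hat, e, sqrt_sq_sub_sq hA.le hc.le, sqrt_sq_sub_sq hA.le hcθ.le, inverseDeriv₂]
    field_simp
  · have hd := ha.deriv_pos _ hp
    rw [hat, e, sqrt_sq_sub_sq hA.le hc.le, sqrt_sq_sub_sq hA.le hcθ.le, inverseDeriv₂, inverseDeriv₃]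
    field_simp
    ring

theorem dτfzero_eq (ha : RegularScaleFactor a)
    (h : InverseProfile (inverseDeriv a) (inverseDeriv₂ a) (inverseDeriv₃ a) v K)
    {τ : ℝ} (hτ : 0 < τ) :
    dτfzero a τ = deriv a τ * lapseDeriv (inverseDeriv₂ a) (inverseDeriv₃ a) (a τ) 0 := by
  have hA := ha.pos hτ
  rw [dτfzero, (ha.integral_substitution hA le_rfl (by positivity) le_rfl le_rfl hτ.le
    (by simp [ha.map_zero]) (map_eq_mul_sin τ)
    (H := fun s => a τ * -((inverseDeriv₂ a (a τ * sin s) +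
      a τ * sin s * inverseDeriv₃ a (a τ * sin s)) * (cos 0 - cos s)))
    fun s _ hc hs hp hat => ?_).1, h.lapseDeriv_eq hA le_rfl (by positivity),
    intervalIntegral.integral_const_mul, intervalIntegral.integral_neg]
  · field_simp
  · have hd := ha.deriv_pos _ hp
    rw [hat, sqrt_sq_sub_sq hA.le hc.le, cos_zero, inverseDeriv₂, inverseDeriv₃]
    field_simp
    ring

end RegularScaleFactor

/-! ### Cosmological time versus angle, and transfer of the results to (τ, ρ). -/

namespace RegularScaleFactor

open Real InverseProfile FermiChart

variable {a : ℝ → ℝ} {v K : ℝ}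

/-- The angle `θ` with `a t₀ = a τ sin θ`, extended to negative times by oddness. -/
def IsAngle (a : ℝ → ℝ) (τ t₀ θ : ℝ) : Prop :=
  (0 ≤ θ ∧ 0 ≤ t₀ ∧ a t₀ = a τ * sin θ) ∨ (θ < 0 ∧ t₀ < 0 ∧ a (-t₀) = a τ * sin (-θ))

theorem exists_angle_of_nonneg (ha : RegularScaleFactor a) {τ x : ℝ} (hx : 0 ≤ x) (hxτ : x < τ) :
    ∃ θ ∈ Ico 0 (π / 2), a x = a τ * sin θ := by
  have hlt := ha.strictMonoOn hx (hx.trans hxτ.le : 0 ≤ τ) hxτ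
  have hle := ha.strictMonoOn.monotoneOn self_mem_Ici hx hx
  obtain ⟨θ, hθ, he⟩ := intermediate_value_Ico (by positivity : (0 : ℝ) ≤ π / 2)
    (by fun_prop : Continuous fun s => a τ * sin s).continuousOn
    (show a x ∈ Ico _ _ by simpa [ha.map_zero] using ⟨by rwa [ha.map_zero] at hle, hlt⟩)
  exact ⟨θ, hθ, he.symm⟩

theorem inverse_mem_Ico (ha : RegularScaleFactor a) {τ θ : ℝ} (hτ : 0 < τ)
    (hθ : θ ∈ Ico 0 (π / 2)) : inverse a (a τ * sin θ) ∈ Ico 0 τ := by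
  have hA := ha.pos hτ
  have h0 : 0 ≤ a τ * sin θ :=
    mul_nonneg hA.le (sin_nonneg_of_nonneg_of_le_pi hθ.1 (by linarith [hθ.2, pi_pos]))
  refine ⟨ha.inverse_nonneg h0, ?_⟩
  rw [← ha.strictMonoOn.lt_iff_lt (ha.inverse_nonneg h0) hτ.le, ha.map_inverse h0]
  have := sin_lt_sin_of_lt_of_le_pi_div_two (by linarith [hθ.1, pi_pos]) le_rfl hθ.2
  rw [sin_pi_div_two] at this
  nlinarith

theorem exists_isAngle (ha : RegularScaleFactor a) {τ t₀ : ℝ} (ht : t₀ ∈ Ioo (-τ) τ) :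
    ∃ θ ∈ Ioo (-(π / 2)) (π / 2), IsAngle a τ t₀ θ := by
  have hpi := pi_pos
  rcases le_or_gt 0 t₀ with h0 | h0
  · obtain ⟨θ, hθ, he⟩ := ha.exists_angle_of_nonneg h0 ht.2
    exact ⟨θ, ⟨by linarith [hθ.1], hθ.2⟩, .inl ⟨hθ.1, h0, he⟩⟩
  · obtain ⟨θ, hθ, he⟩ := ha.exists_angle_of_nonneg (neg_nonneg.2 h0.le) (neg_lt.1 ht.1)
    have hne : θ ≠ 0 := by
      rintro rfl
      have := ha.pos (neg_pos.2 h0)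
      simp [he] at this
    have := lt_of_le_of_ne hθ.1 hne.symm
    exact ⟨-θ, ⟨by linarith [hθ.2], by linarith⟩,
      .inr ⟨by linarith, h0, by rwa [neg_neg]⟩⟩

theorem exists_time (ha : RegularScaleFactor a) {τ θ : ℝ} (hτ : 0 < τ)
    (hθ : θ ∈ Ioo (-(π / 2)) (π / 2)) : ∃ t₀ ∈ Ioo (-τ) τ, IsAngle a τ t₀ θ := by
  have hpi := pi_pos
  have hA := ha.pos hτ
  have hmap : ∀ x ∈ Ico 0 (π / 2), a (inverse a (a τ * sin x)) = a τ * sin x := fun x hx =>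
    ha.map_inverse (mul_nonneg hA.le
      (sin_nonneg_of_nonneg_of_le_pi hx.1 (by linarith [hx.2])))
  rcases le_or_gt 0 θ with h0 | h0
  · have hm := ha.inverse_mem_Ico hτ ⟨h0, hθ.2⟩
    exact ⟨_, ⟨by linarith [hm.1], hm.2⟩, .inl ⟨h0, hm.1, hmap θ ⟨h0, hθ.2⟩⟩⟩
  · have hθ' : -θ ∈ Ico 0 (π / 2) := ⟨by linarith, by linarith [hθ.1]⟩
    have hm := ha.inverse_mem_Ico hτ hθ'
    have hp := ha.inverse_pos (mul_pos hA (sin_pos_of_mem ⟨neg_pos.2 h0, hθ'.2.le⟩))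
    exact ⟨-inverse a (a τ * sin (-θ)), ⟨by linarith [hm.2], by linarith⟩,
      .inr ⟨h0, by linarith, by rw [neg_neg, hmap _ hθ']⟩⟩

theorem IsAngle.time_unique (ha : RegularScaleFactor a) {τ t₀ t₁ θ : ℝ} (h₀ : IsAngle a τ t₀ θ)
    (h₁ : IsAngle a τ t₁ θ) : t₀ = t₁ := by
  rcases h₀ with ⟨p, q, e⟩ | ⟨p, q, e⟩ <;> rcases h₁ with ⟨p', q', e'⟩ | ⟨p', q', e'⟩
  · exact ha.strictMonoOn.injOn q q' (e.trans e'.symm)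
  · exact absurd p (not_le.2 p')
  · exact absurd p' (not_le.2 p)
  · exact neg_injective (ha.strictMonoOn.injOn (neg_nonneg.2 q.le) (neg_nonneg.2 q'.le)
      (e.trans e'.symm))

theorem IsAngle.time_eq_zero_iff (ha : RegularScaleFactor a) {τ t₀ θ : ℝ} (hτ : 0 < τ)
    (hθ : θ ∈ Ioo (-(π / 2)) (π / 2)) (h₀ : IsAngle a τ t₀ θ) : t₀ = 0 ↔ θ = 0 := by
  have hA := ha.pos hτ
  rcases h₀ with ⟨p, q, e⟩ | ⟨p, q, e⟩
  · constructor
    · rintro rfl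
      rw [ha.map_zero, zero_eq_mul, or_iff_right hA.ne',
        sin_eq_zero_iff_of_lt_of_lt (by linarith [pi_pos]) (by linarith [hθ.2, pi_pos])] at e
      exact e
    · rintro rfl
      rw [sin_zero, mul_zero, ← ha.map_zero] at e
      exact ha.strictMonoOn.injOn q self_mem_Ici e
  · exact iff_of_false q.ne p.ne

theorem IsAngle.properDist_eq (ha : RegularScaleFactor a)
    (h : InverseProfile (inverseDeriv a) (inverseDeriv₂ a) (inverseDeriv₃ a) v K)
    {τ t₀ θ : ℝ} (hτ : 0 < τ) (hθ : θ ∈ Ioo (-(π / 2)) (π / 2)) (h₀ : IsAngle a τ t₀ θ) :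
    properDist a τ t₀ = dist (inverseDeriv a) (a τ) θ := by
  rcases h₀ with ⟨p, q, e⟩ | ⟨p, q, e⟩
  · exact ha.properDist_of_nonneg hτ p hθ.2.le q e
  · have := ha.properDist_neg h hτ (neg_nonneg.2 p.le) (by linarith [hθ.1]) (neg_nonneg.2 q.le) e
    rwa [neg_neg, neg_neg] at this

theorem mem_domain_iff (ha : RegularScaleFactor a) {p : ℝ × ℝ} :
    p ∈ domain a ↔ 0 < p.1 ∧ (a p.1, p.2) ∈ region (inverseDeriv a) := by
  refine ⟨fun hp => ⟨hp.1, ha.pos hp.1, hp.2.1, ?_⟩, fun hp => ⟨hp.1, hp.2.2.1, ?_⟩⟩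
  · rw [← ha.radius_eq hp.1]; exact hp.2.2
  · rw [ha.radius_eq hp.1]; exact hp.2.2.2

theorem isOpen_domain (ha : RegularScaleFactor a)
    (h : InverseProfile (inverseDeriv a) (inverseDeriv₂ a) (inverseDeriv₃ a) v K) :
    IsOpen (domain a) := by
  have hc : ContinuousOn (fun p : ℝ × ℝ => (a p.1, p.2)) {p | 0 < p.1} := by
    refine ContinuousOn.prodMk ?_ continuousOn_snd
    exact ha.continuousOn.comp continuousOn_fst fun p (hp : 0 < p.1) => hp.le
  have : domain a = {p : ℝ × ℝ | 0 < p.1} ∩ (fun p : ℝ × ℝ => (a p.1, p.2)) ⁻¹'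
      region (inverseDeriv a) := by
    ext p
    exact ha.mem_domain_iff
  rw [this]
  exact hc.isOpen_inter_preimage (isOpen_lt continuous_const continuous_fst) h.isOpen_region

theorem existsUnique_time (ha : RegularScaleFactor a)
    (h : InverseProfile (inverseDeriv a) (inverseDeriv₂ a) (inverseDeriv₃ a) v K)
    {τ ρ : ℝ} (hp : (τ, ρ) ∈ domain a) :
    ∃! t₀ : ℝ, t₀ ∈ Ioo (-τ) τ ∧ properDist a τ t₀ = ρ := by
  obtain ⟨hτ, hr⟩ := ha.mem_domain_iff.1 hp
  have hm := h.angle_mem hr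
  obtain ⟨t₀, ht, hang⟩ := ha.exists_time hτ hm
  refine ⟨t₀, ⟨ht, (hang.properDist_eq ha h hτ hm).trans (h.dist_angle hr)⟩, ?_⟩
  rintro t₁ ⟨ht₁, hd⟩
  obtain ⟨θ, hθ, hang₁⟩ := ha.exists_isAngle ht₁
  rw [hang₁.properDist_eq ha h hτ hθ] at hd
  have := h.angle_eq hr hθ hd
  subst this
  exact hang₁.time_unique ha hang

theorem isAngle_cosmicTime (ha : RegularScaleFactor a)
    (h : InverseProfile (inverseDeriv a) (inverseDeriv₂ a) (inverseDeriv₃ a) v K)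
    {τ ρ : ℝ} (hp : (τ, ρ) ∈ domain a) :
    IsAngle a τ (cosmicTime a τ ρ) (angle (inverseDeriv a) (a τ, ρ)) ∧
      cosmicTime a τ ρ ∈ Ioo (-τ) τ := by
  obtain ⟨hτ, hr⟩ := ha.mem_domain_iff.1 hp
  obtain ⟨ht, hd⟩ := Classical.epsilon_spec (ha.existsUnique_time h hp).exists
  refine ⟨?_, ht⟩
  obtain ⟨θ, hθ, hang⟩ := ha.exists_isAngle ht
  rw [hang.properDist_eq ha h hτ hθ] at hd
  rw [h.angle_eq hr hθ hd]
  exact hang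

theorem angle_eq_zero_iff (ha : RegularScaleFactor a)
    (h : InverseProfile (inverseDeriv a) (inverseDeriv₂ a) (inverseDeriv₃ a) v K)
    {τ ρ : ℝ} (hp : (τ, ρ) ∈ domain a) :
    angle (inverseDeriv a) (a τ, ρ) = 0 ↔ ρ = radius a τ := by
  obtain ⟨hτ, hr⟩ := ha.mem_domain_iff.1 hp
  have hpi := pi_pos
  rw [ha.radius_eq hτ]
  constructor
  · intro h0
    have := h.dist_angle hr
    rw [h0] at this
    exact this.symm
  · intro h0
    exact h.angle_eq hr ⟨by linarith, by linarith⟩ h0.symm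

theorem radius_mem_domain (ha : RegularScaleFactor a)
    (h : InverseProfile (inverseDeriv a) (inverseDeriv₂ a) (inverseDeriv₃ a) v K)
    {τ : ℝ} (hτ : 0 < τ) : (τ, radius a τ) ∈ domain a := by
  have hpi := pi_pos
  have hpos : 0 < radius a τ := by
    have := h.dist_strictAntiOn (ha.pos hτ) (a := 0) (b := π / 2) ⟨by linarith, by linarith⟩
      ⟨by linarith, le_rfl⟩ (by linarith)
    rwa [dist_pi_div_two, ← ha.radius_eq hτ] at this
  exact ⟨hτ, hpos, by simp only; linarith⟩

theorem fF_eq (ha : RegularScaleFactor a)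
    (h : InverseProfile (inverseDeriv a) (inverseDeriv₂ a) (inverseDeriv₃ a) v K)
    {τ ρ : ℝ} (hp : (τ, ρ) ∈ domain a) :
    fF a τ ρ = potential (inverseDeriv a) (inverseDeriv₂ a) (a τ, ρ) := by
  obtain ⟨hτ, hr⟩ := ha.mem_domain_iff.1 hp
  have hm := h.angle_mem hr
  rw [fF, f, potential]
  rcases (ha.isAngle_cosmicTime h hp).1 with ⟨p, q, e⟩ | ⟨p, q, e⟩
  · rw [if_pos q, reflect_of_nonneg _ p]
    exact ha.fNonneg_eq h hτ p hm.2.le q e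
  · rw [if_neg (not_le.2 q), reflect_of_nonpos _ p.le,
      ha.fNonneg_eq h hτ (neg_nonneg.2 p.le) (by linarith [hm.1]) (neg_nonneg.2 q.le) e,
      ha.fNonneg_eq h hτ le_rfl (by positivity) le_rfl (by simp [ha.map_zero])]

/-- For x > 0, J is `slope` divided by a'(x), and both have limits as x → 0⁺. This yields
convergence of the improper integral without absolute integrability. -/
theorem tendsto_J (ha : RegularScaleFactor a)
    (h : InverseProfile (inverseDeriv a) (inverseDeriv₂ a) (inverseDeriv₃ a) v K)
    (hv : Tendsto (deriv a) (𝓝[>] 0) (𝓝 v)) (hv0 : v ≠ 0) {τ : ℝ} (hτ : 0 < τ) :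
    Tendsto (J a τ) (𝓝[>] 0)
      (𝓝 (slope (inverseDeriv a) (inverseDeriv₂ a) v (a τ) 0 / v)) := by
  have hA := ha.pos hτ
  have cs : Continuous (slope (inverseDeriv a) (inverseDeriv₂ a) v (a τ)) :=
    h.continuousOn_slope.comp_continuous (f := fun θ : ℝ => (a τ, θ)) (by fun_prop) fun _ => hA
  have t1 : Tendsto (fun x => arcsin (a x / a τ)) (𝓝[>] 0) (𝓝 0) := by
    have := (continuous_arcsin.tendsto _).comp (ha.tendsto_zero.div_const (a τ))
    simpa [Function.comp_def] using this
  refine (((cs.tendsto 0).comp t1).div hv hv0).congr' ?_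
  filter_upwards [Ioo_mem_nhdsGT hτ] with x hx
  have hax := ha.pos hx.1
  have hlt := ha.strictMonoOn hx.1.le hτ.le hx.2
  have hd := ha.deriv_pos x hx.1
  have hsin : sin (arcsin (a x / a τ)) = a x / a τ :=
    sin_arcsin (by linarith [div_pos hax hA]) ((div_le_one hA).2 hlt.le)
  have := ha.deriv_mul_J h hτ (arcsin_pos.2 (div_pos hax hA)) (arcsin_le_pi_div_two _) hx.1.le
    (by rw [hsin]; field_simp)
  simp only [Function.comp, Pi.div_apply]
  rw [← this]
  field_simp

/-- Both alternatives are the value of `slope` at angle 0: for v = 0 only the term 1/A survives, and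
for v ≠ 0 it is recovered from the limit of J. -/
theorem dρfBang_eq (ha : RegularScaleFactor a)
    (h : InverseProfile (inverseDeriv a) (inverseDeriv₂ a) (inverseDeriv₃ a) v K)
    (hv : Tendsto (deriv a) (𝓝[>] 0) (𝓝 v)) {τ : ℝ} (hτ : 0 < τ) :
    dρfBang a v τ = slope (inverseDeriv a) (inverseDeriv₂ a) v (a τ) 0 := by
  rw [dρfBang]
  split_ifs with hv0
  · simp [InverseProfile.slope, rate, hv0]
  · rw [Jzero, (ha.tendsto_J h hv hv0 hτ).limUnder_eq]
    field_simp

theorem dρfF_eq (ha : RegularScaleFactor a)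
    (h : InverseProfile (inverseDeriv a) (inverseDeriv₂ a) (inverseDeriv₃ a) v K)
    (hv : Tendsto (deriv a) (𝓝[>] 0) (𝓝 v)) {τ ρ : ℝ} (hp : (τ, ρ) ∈ domain a) :
    dρfF a v τ ρ = slope (inverseDeriv a) (inverseDeriv₂ a) v (a τ)
      (angle (inverseDeriv a) (a τ, ρ)) := by
  obtain ⟨hτ, hr⟩ := ha.mem_domain_iff.1 hp
  have hm := h.angle_mem hr
  have hz := ha.angle_eq_zero_iff h hp
  rw [dρfF]
  split_ifs with hρ
  · rw [hz.2 hρ, ha.dρfBang_eq h hv hτ]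
  · rcases (ha.isAngle_cosmicTime h hp).1 with ⟨p, q, e⟩ | ⟨p, q, e⟩
    · rw [abs_of_nonneg q]
      exact ha.deriv_mul_J h hτ (p.lt_of_ne' (mt hz.1 hρ)) hm.2.le q e
    · rw [abs_of_neg q, ← slope_neg]
      exact ha.deriv_mul_J h hτ (neg_pos.2 p) (by linarith [hm.1]) (neg_nonneg.2 q.le) e

theorem dt₀f_mul_dτt₀ (ha : RegularScaleFactor a) {τ t₀ : ℝ} (ht : t₀ ∈ Ioo (-τ) τ)
    (h0 : t₀ ≠ 0) :
    dt₀f a τ t₀ * dτt₀ a τ t₀ =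
      -(deriv a |t₀| * J a τ |t₀|) * (radiusDeriv a τ - dτG a τ t₀) := by
  have hp := abs_pos.2 h0
  have hax := ha.pos hp
  have hlt : |t₀| < τ := abs_lt.2 ht
  have haτ := ha.strictMonoOn hp.le (hp.trans hlt).le hlt
  have hs : 0 < √(a τ ^ 2 - a |t₀| ^ 2) := sqrt_pos.2 (by nlinarith)
  rw [dt₀f, dτt₀]
  field_simp

/-- Away from the big bang, `dτG` contributes a term `slope` · `flux` · tan θ / A that cancels the
one in `I₁_add_I₂`. For negative times, the reflection identities of `dτG` and `distDeriv` reduce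
the formula to the positive angle -θ. -/
theorem dτfF_eq (ha : RegularScaleFactor a)
    (h : InverseProfile (inverseDeriv a) (inverseDeriv₂ a) (inverseDeriv₃ a) v K)
    (hv : Tendsto (deriv a) (𝓝[>] 0) (𝓝 v)) {τ ρ : ℝ} (hp : (τ, ρ) ∈ domain a) :
    dτfF a v τ ρ = deriv a τ * (reflect (lapseDeriv (inverseDeriv₂ a) (inverseDeriv₃ a) (a τ))
        (angle (inverseDeriv a) (a τ, ρ)) -
      slope (inverseDeriv a) (inverseDeriv₂ a) v (a τ) (angle (inverseDeriv a) (a τ, ρ)) *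
        distDeriv (inverseDeriv a) (inverseDeriv₂ a) (a τ) (angle (inverseDeriv a) (a τ, ρ))) := by
  obtain ⟨hτ, hr⟩ := ha.mem_domain_iff.1 hp
  have hm := h.angle_mem hr
  have hz := ha.angle_eq_zero_iff h hp
  have hA := ha.pos hτ
  obtain ⟨hang, ht⟩ := ha.isAngle_cosmicTime h hp
  have hne := hang.time_eq_zero_iff ha hτ hm
  rw [dτfF]
  split_ifs with hρ
  · rw [hz.2 hρ, ha.dρfBang_eq h hv hτ, reflect_of_nonneg _ le_rfl, ha.dτfzero_eq h hτ,
      ha.radiusDeriv_eq hτ]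
    ring
  · have hθ0 := mt hz.1 hρ
    rw [ha.dt₀f_mul_dτt₀ ht (mt hne.1 hθ0), ha.radiusDeriv_eq hτ, dτf]
    generalize angle (inverseDeriv a) (a τ, ρ) = θ at *
    generalize cosmicTime a τ ρ = t₀ at *
    rcases hang with ⟨p, q, e⟩ | ⟨p, q, e⟩
    · have hp' := p.lt_of_ne' hθ0
      rw [if_pos (q.lt_of_ne' (mt hne.1 hθ0)), abs_of_nonneg q, reflect_of_nonneg _ p,
        ha.I₁_add_I₂ h hτ hp' hm.2 q e, ha.deriv_mul_J h hτ hp' hm.2.le q e,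
        ha.dτG_eq h hτ p hm.2 q e]
      ring
    · have hp' := neg_pos.2 p
      have hlt : -θ < π / 2 := by linarith [hm.1]
      have e1 := ha.I₁_add_I₂ h hτ hp' hlt (neg_nonneg.2 q.le) e
      have e2 := dτG_neg a τ (-t₀)
      rw [neg_neg, ha.dτG_eq h hτ hp'.le hlt (neg_nonneg.2 q.le) e] at e2
      have e3 := h.distDeriv_neg (a τ) (-θ)
      rw [neg_neg] at e3
      rw [if_neg (not_lt.2 q.le), abs_of_neg q, reflect_of_nonpos _ p.le, sub_sub, e1,
        ha.deriv_mul_J h hτ hp' hlt.le (neg_nonneg.2 q.le) e, e2, ha.dτfzero_eq h hτ, e3,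
        slope_neg]
      ring

theorem hasDerivAt_fF_right (ha : RegularScaleFactor a)
    (h : InverseProfile (inverseDeriv a) (inverseDeriv₂ a) (inverseDeriv₃ a) v K)
    (hv : Tendsto (deriv a) (𝓝[>] 0) (𝓝 v)) {τ ρ : ℝ} (hp : (τ, ρ) ∈ domain a) :
    HasDerivAt (fun r => fF a τ r) (dρfF a v τ ρ) ρ := by
  obtain ⟨hτ, hr⟩ := ha.mem_domain_iff.1 hp
  have hd := (h.hasFDerivAt_potential hr).comp_hasDerivAt ρ
    (f := fun r => (a τ, r)) ((hasDerivAt_const ρ (a τ)).prodMk (hasDerivAt_id ρ))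
  refine (hd.congr_of_eventuallyEq ?_).congr_deriv ?_
  · have : ∀ᶠ r in 𝓝 ρ, (τ, r) ∈ domain a :=
      (by fun_prop : Continuous fun r : ℝ => (τ, r)).continuousAt.eventually
        ((ha.isOpen_domain h).mem_nhds hp)
    filter_upwards [this] with r hr using ha.fF_eq h hr
  · rw [ha.dρfF_eq h hv hp]; simp

theorem hasDerivAt_fF_left (ha : RegularScaleFactor a)
    (h : InverseProfile (inverseDeriv a) (inverseDeriv₂ a) (inverseDeriv₃ a) v K)
    (hv : Tendsto (deriv a) (𝓝[>] 0) (𝓝 v)) {τ ρ : ℝ} (hp : (τ, ρ) ∈ domain a) :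
    HasDerivAt (fun s => fF a s ρ) (dτfF a v τ ρ) τ := by
  obtain ⟨hτ, hr⟩ := ha.mem_domain_iff.1 hp
  have hd := (h.hasFDerivAt_potential hr).comp_hasDerivAt τ
    (f := fun s => (a s, ρ)) ((ha.hasDerivAt hτ).prodMk (hasDerivAt_const τ ρ))
  refine (hd.congr_of_eventuallyEq ?_).congr_deriv ?_
  · have : ∀ᶠ s in 𝓝 τ, (s, ρ) ∈ domain a :=
      (by fun_prop : Continuous fun s : ℝ => (s, ρ)).continuousAt.eventually
        ((ha.isOpen_domain h).mem_nhds hp)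
    filter_upwards [this] with s hs using ha.fF_eq h hs
  · rw [ha.dτfF_eq h hv hp]; simp; ring

theorem contDiffOn_gττ (ha : RegularScaleFactor a)
    (h : InverseProfile (inverseDeriv a) (inverseDeriv₂ a) (inverseDeriv₃ a) v K) :
    ContDiffOn ℝ 1 (fun p : ℝ × ℝ => gττ a p.1 p.2) (domain a) := by
  have hfst : MapsTo Prod.fst (domain a) (Ioi 0) := fun p hp => hp.1
  have c1 : ContDiffOn ℝ 1 (fun p : ℝ × ℝ => a p.1) (domain a) :=
    (ha.contDiffOn.of_le (by norm_num)).comp contDiffOn_fst hfst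
  have c2 : ContDiffOn ℝ 1 (fun p : ℝ × ℝ => deriv a p.1) (domain a) :=
    ha.contDiffOn_deriv.comp contDiffOn_fst hfst
  have c3 : ContDiffOn ℝ 1
      (fun p : ℝ × ℝ => potential (inverseDeriv a) (inverseDeriv₂ a) (a p.1, p.2)) (domain a) :=
    h.contDiffOn_potential.comp (c1.prodMk contDiffOn_snd) fun p hp => (ha.mem_domain_iff.1 hp).2
  refine ((contDiffOn_const (c := (1 : ℝ))).sub (c2.mul c3)).pow 2 |>.neg.congr fun p hp => ?_
  rw [gττ, ha.fF_eq h hp]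

/-- Up to the big bang the angle is nonnegative, so f is the unreflected `lapse` and `lapse_le`
gives f ≤ 1 / a'(τ). -/
theorem one_sub_deriv_mul_fF_nonneg (ha : RegularScaleFactor a)
    (h : InverseProfile (inverseDeriv a) (inverseDeriv₂ a) (inverseDeriv₃ a) v K)
    {τ ρ : ℝ} (hp : (τ, ρ) ∈ domain a) (hρ : ρ ≤ radius a τ) :
    0 ≤ 1 - deriv a τ * fF a τ ρ := by
  obtain ⟨hτ, hr⟩ := ha.mem_domain_iff.1 hp
  have hm := h.angle_mem hr
  have hd := ha.deriv_pos τ hτ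
  have hpi := pi_pos
  have h0 : 0 ≤ angle (inverseDeriv a) (a τ, ρ) := by
    by_contra! hlt
    have := h.dist_strictAntiOn (ha.pos hτ) (Ioo_subset_Icc_self hm) ⟨by linarith, by linarith⟩ hlt
    rw [h.dist_angle hr, ← ha.radius_eq hτ] at this
    exact absurd hρ (not_le.2 this)
  have hle := h.lapse_le (ha.pos hτ) (angle (inverseDeriv a) (a τ, ρ))
  rw [inverseDeriv, ha.inverse_map hτ.le, le_div_iff₀ hd] at hle
  rw [ha.fF_eq h hp, potential, reflect_of_nonneg _ h0]
  linarith

end RegularScaleFactor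

/-! ### Assembly: chain rule for `gττ`. -/

theorem theorem5p8 (a : ℝ → ℝ) (ha : StronglyRegularScaleFactor a)
    -- `v = a'(0⁺)`, and the two alternatives for the behaviour at the big bang
    (v : ℝ) (hv : Tendsto (deriv a) (𝓝[>] 0) (𝓝 v))
    (hcase : (v = 0 ∧ ∃ ε : ℝ, 0 < ε ∧ ∀ t ∈ Ioo 0 ε, 0 ≤ deriv (deriv a) t) ∨ 0 < v)
    -- the third derivative exists on `(0, ∞)` and satisfies the bound
    (ha₃ : ∀ t, 0 < t → DifferentiableAt ℝ (deriv (deriv a)) t)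
    (C : ℝ) (hC : ∀ t, 0 < t → |deriv (deriv (deriv a)) t * a t ^ 2 / deriv a t ^ 3| ≤ C) :
    -- `t₀` is well defined on the open set `D`, and `t₀ = 0` exactly on the big bang locus
    IsOpen (FermiChart.domain a) ∧
    (∀ τ ρ : ℝ, (τ, ρ) ∈ FermiChart.domain a →
      (∃! t₀ : ℝ, t₀ ∈ Ioo (-τ) τ ∧ FermiChart.properDist a τ t₀ = ρ) ∧
      (FermiChart.cosmicTime a τ ρ = 0 ↔ ρ = FermiChart.radius a τ)) ∧
    -- the big bang locus lies in `D`
    (∀ τ : ℝ, 0 < τ → (τ, FermiChart.radius a τ) ∈ FermiChart.domain a) ∧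
    -- `g_ττ` is continuously differentiable on `D`
    ContDiffOn ℝ 1 (fun p : ℝ × ℝ => FermiChart.gττ a p.1 p.2) (FermiChart.domain a) ∧
    -- the improper integral in the formulas converges when `v > 0`
    (0 < v → ∀ τ : ℝ, 0 < τ →
      Tendsto (FermiChart.J a τ) (𝓝[>] 0) (𝓝 (FermiChart.Jzero a τ))) ∧
    -- the derivative formulas, on all of `D`
    (∀ τ ρ : ℝ, (τ, ρ) ∈ FermiChart.domain a →
      HasDerivAt (fun r => FermiChart.fF a τ r) (FermiChart.dρfF a v τ ρ) ρ ∧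
      HasDerivAt (fun s => FermiChart.fF a s ρ) (FermiChart.dτfF a v τ ρ) τ ∧
      HasDerivAt (fun r => FermiChart.gττ a τ r)
        (2 * (1 - deriv a τ * FermiChart.fF a τ ρ) *
          (deriv a τ * FermiChart.dρfF a v τ ρ)) ρ ∧
      HasDerivAt (fun s => FermiChart.gττ a s ρ)
        (2 * (1 - deriv a τ * FermiChart.fF a τ ρ) *
          (deriv (deriv a) τ * FermiChart.fF a τ ρ + deriv a τ * FermiChart.dτfF a v τ ρ)) τ ∧
      -- up to and including the big bang, the common factor is `√(-g_ττ)`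
      (ρ ≤ FermiChart.radius a τ →
        1 - deriv a τ * FermiChart.fF a τ ρ = √(-FermiChart.gττ a τ ρ))) := by
  have hr := ha.toRegularScaleFactor
  obtain ⟨K, h⟩ := RegularScaleFactor.inverseProfile ha hv hcase ha₃ hC
  refine ⟨hr.isOpen_domain h, fun τ ρ hp => ⟨hr.existsUnique_time h hp, ?_⟩,
    fun τ hτ => hr.radius_mem_domain h hτ, hr.contDiffOn_gττ h, fun hv0 τ hτ => ?_,
    fun τ ρ hp => ?_⟩
  · obtain ⟨hτ, hreg⟩ := hr.mem_domain_iff.1 hp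
    rw [← hr.angle_eq_zero_iff h hp]
    exact (hr.isAngle_cosmicTime h hp).1.time_eq_zero_iff hr hτ (h.angle_mem hreg)
  · have hJ := hr.tendsto_J h hv hv0.ne' hτ
    rwa [FermiChart.Jzero, hJ.limUnder_eq]
  · have d1 := hr.hasDerivAt_fF_right h hv hp
    have d2 := hr.hasDerivAt_fF_left h hv hp
    have d3 := hr.hasDerivAt_deriv hp.1
    refine ⟨d1, d2, ?_, ?_, fun hρ => ?_⟩
    · refine (((d1.const_mul (deriv a τ)).const_sub 1).pow 2).neg.congr_deriv ?_
      push_cast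
      ring
    · refine (((d3.mul d2).const_sub 1).pow 2).neg.congr_deriv ?_
      simp only [Pi.mul_apply]
      push_cast
      ring
    · rw [FermiChart.gττ, neg_neg, Real.sqrt_sq (hr.one_sub_deriv_mul_fF_nonneg h hp hρ)]
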